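/- Let $G$ be a Lie group and $\pi: P\to M$ a smooth (right) principal $G$-bundle over a manifold $M$ (manifolds are finite-dimensional, Hausdorff, without boundary). Let $\mathcal{G}(P)=(P\times P)/G\rightrightarrows M$ be its gauge groupoid, the orbit space of the diagonal action, with quotient map $q:P\times P\to\mathcal{G}(P)$, $q(p_1,p_2)=\overline{(p_1,p_2)}$, target $\overline{(p_1,p_2)}\mapsto\pi(p_1)$, source $\overline{(p_1,p_2)}\mapsto \pi(p_2)$ and multiplication $\overline{(p_1,p_2)}\cdot\overline{(p_2,p_3)}=\overline{(p_1,p_3)}$. For $(X,Y)\in TP\times TP$ write $\overline{(X,Y)}=Tq(X,Y)\in T\mathcal{G}(P)$. Let $\theta\in\Omega^1(P,\mathfrak{g})$ be a principal connection, with associated vertical projection $\Theta(X)=(\theta(X))_P$, where $u_P$ denotes the infinitesimal generator of the action given by $u\in\mathfrak g$. Let $K\in\Omega^1(\mathcal{G}(P),T\mathcal{G}(P))$ be the corresponding projection, i.e. $K(\overline{(X,Y)})=\overline{(\Theta(X),\Theta(Y))}$ for all $X,Y\in TP$. Then there is exactly one vector-valued $2$-form $R_K\in\Omega^2(\mathcal{G}(P),T\mathcal{G}(P))$,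 the curvature of $K$, such that $$R_K(X,Y)=K\big([(\mathrm{Id}-K)(X),(\mathrm{Id}-K)(Y)]\big)\quad\text{for all vector fields } X,Y \text{ on } \mathcal{G}(P),$$ and $R_K$ is multiplicative. Here a vector-valued $k$-form $R$ on (the space of arrows of) a Lie groupoid $\mathcal{G}\rightrightarrows M$ is called multiplicative if there is a vector-valued $k$-form $R_M\in\Omega^k(M,TM)$ such that $(R,R_M)$ is a groupoid morphism from $\oplus^kT\mathcal{G}\rightrightarrows\oplus^kTM$ to the tangent groupoid $T\mathcal{G}\rightrightarrows TM$, whose structure maps are the derivatives of those of $\mathcal{G}$. -/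

import Mathlib

open Set Function Bundle Topology
open scoped Manifold ContDiff

noncomputable section

/-! ### Vector-valued forms and their curvature -/

section Forms

variable {E H : Type*} [NormedAddCommGroup E] [NormedSpace ℝ E] [TopologicalSpace H]
  (I : ModelWithCorners ℝ E H) (N : Type*) [TopologicalSpace N] [ChartedSpace H N]

/-- `X` is a smooth vector field on the set `U`. -/
def SmoothFieldOn [IsManifold I ∞ N] (X : ∀ x : N, TangentSpace I x) (U : Set N) : Prop :=
  ContMDiffOn I I.tangent ∞ (fun x => (⟨x, X x⟩ : TangentBundle I N)) U

/-- A vector-valued `k`-form on `N`, that is, a smooth section of `⋀ᵏ T*N ⊗ TN`.  Smoothness means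
that the form sends smooth vector fields on an open set to a smooth vector field on that set. -/
structure VectorForm [IsManifold I ∞ N] (k : ℕ) where
  toFun : ∀ x : N, (TangentSpace I x) [⋀^Fin k]→L[ℝ] (TangentSpace I x)
  smooth' : ∀ U : Set N, IsOpen U → ∀ X : Fin k → ∀ x : N, TangentSpace I x,
    (∀ i, SmoothFieldOn I N (X i) U) → SmoothFieldOn I N (fun x => toFun x fun i => X i x) U

variable {I N}

instance [IsManifold I ∞ N] (k : ℕ) : CoeFun (VectorForm I N k)
    (fun _ => ∀ x : N, (TangentSpace I x) [⋀^Fin k]→L[ℝ] (TangentSpace I x)) :=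
  ⟨VectorForm.toFun⟩

/-- `R` is the curvature of the projection `K : TN → TN`:
`R(X, Y) = K([(Id - K) X, (Id - K) Y])` for all smooth vector fields `X`, `Y` on `N`. -/
def IsCurvature [IsManifold I ∞ N] (K : VectorForm I N 1) (R : VectorForm I N 2) : Prop :=
  ∀ X Y : ∀ x : N, TangentSpace I x, SmoothFieldOn I N X univ → SmoothFieldOn I N Y univ →
    ∀ x : N, R x ![X x, Y x] =
      K x fun _ => VectorField.mlieBracket I
        (fun y => X y - K y fun _ => X y) (fun y => Y y - K y fun _ => Y y) x

end Forms

/-! ### Lie groupoids and multiplicative vector-valued forms -/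

/-- A groupoid with space of arrows `A` and space of objects `M`;
`mul g h` is the product of the composable pair `(g, h)`, for which `src g = tgt h`. -/
structure GroupoidOver (A M : Type*) where
  src : A → M
  tgt : A → M
  unit : M → A
  inv : A → A
  mul : ∀ g h : A, src g = tgt h → A
  src_unit : ∀ x, src (unit x) = x
  tgt_unit : ∀ x, tgt (unit x) = x
  src_inv : ∀ g, src (inv g) = tgt g
  tgt_inv : ∀ g, tgt (inv g) = src g
  src_mul : ∀ g h c, src (mul g h c) = src h
  tgt_mul : ∀ g h c, tgt (mul g h c) = tgt g
  mul_assoc : ∀ (g h k : A) (c : src g = tgt h) (d : src h = tgt k),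
    mul (mul g h c) k ((src_mul g h c).trans d) = mul g (mul h k d) (c.trans (tgt_mul h k d).symm)
  unit_mul : ∀ g, mul (unit (tgt g)) g (src_unit _) = g
  mul_unit : ∀ g, mul g (unit (src g)) (tgt_unit _).symm = g
  inv_mul : ∀ g, mul (inv g) g (src_inv g) = unit (src g)
  mul_inv : ∀ g, mul g (inv g) (tgt_inv g).symm = unit (tgt g)

namespace GroupoidOver

variable {A M : Type*} (𝒢 : GroupoidOver A M)

/-- The set of composable arrows, as a subset of `A × A`. -/
def composable : Set (A × A) := {x | 𝒢.src x.1 = 𝒢.tgt x.2}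

open Classical in
/-- The multiplication, extended arbitrarily to all pairs of arrows. -/
def mulExt (x : A × A) : A := if c : 𝒢.src x.1 = 𝒢.tgt x.2 then 𝒢.mul x.1 x.2 c else x.1

end GroupoidOver

section LieGroupoids

variable {EA HA EM HM : Type*}
  [NormedAddCommGroup EA] [NormedSpace ℝ EA] [TopologicalSpace HA]
  [NormedAddCommGroup EM] [NormedSpace ℝ EM] [TopologicalSpace HM]
  (IA : ModelWithCorners ℝ EA HA) (IM : ModelWithCorners ℝ EM HM)
  (A M : Type*) [TopologicalSpace A] [ChartedSpace HA A] [TopologicalSpace M] [ChartedSpace HM M]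

/-- A Lie groupoid: a groupoid with smooth structure maps, whose source and target are submersions.
The composable arrows form an embedded submanifold of `A × A`, and smoothness of the multiplication
is smoothness along this subset. -/
structure LieGroupoid extends GroupoidOver A M where
  contMDiff_src : ContMDiff IA IM ∞ src
  contMDiff_tgt : ContMDiff IA IM ∞ tgt
  submersion_src : ∀ g, Surjective (mfderiv IA IM src g)
  submersion_tgt : ∀ g, Surjective (mfderiv IA IM tgt g)
  contMDiff_unit : ContMDiff IM IA ∞ unit
  contMDiff_inv : ContMDiff IA IA ∞ inv
  contMDiffOn_mul : ContMDiffOn (IA.prod IA) IA ∞ toGroupoidOver.mulExt toGroupoidOver.composable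

variable {IA IM A M}

namespace LieGroupoid

variable (𝒢 : LieGroupoid IA IM A M)

/-- The tangent multiplication `Tm` at a composable pair `(g, h)`.  Only its values at pairs `(X, Y)`
with `Ts(X) = Tt(Y)`, i.e. at the vectors tangent to the submanifold of composable arrows, are
meaningful: on these the derivative of `m` along this submanifold is uniquely determined. -/
def tangentMul (g h : A) (X : TangentSpace IA g) (Y : TangentSpace IA h) :
    TangentSpace IA (𝒢.mulExt (g, h)) :=
  mfderivWithin (IA.prod IA) IA 𝒢.mulExt 𝒢.composable (g, h) (X, Y)

/-- `X` and `Y` are composable arrows of the tangent groupoid: `Ts(X) = Tt(Y)` in `TM`. -/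
def TangentComposable (g h : A) (X : TangentSpace IA g) (Y : TangentSpace IA h) : Prop :=
  tangentMap IA IM 𝒢.src (⟨g, X⟩ : TangentBundle IA A) =
    tangentMap IA IM 𝒢.tgt (⟨h, Y⟩ : TangentBundle IA A)

/-- The form `K` is multiplicative: for some form `K_M` on the base, `(K, K_M)` is a morphism from
the groupoid `⊕ᵏ TA ⇉ ⊕ᵏ TM` to the groupoid `TA ⇉ TM`. -/
def IsMultiplicative [IsManifold IA ∞ A] [IsManifold IM ∞ M] {k : ℕ} (K : VectorForm IA A k) :
    Prop :=
  ∃ KM : VectorForm IM M k,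
    (∀ (g : A) (X : Fin k → TangentSpace IA g),
      mfderiv IA IM 𝒢.src g (K g X) = KM (𝒢.src g) fun i => mfderiv IA IM 𝒢.src g (X i)) ∧
    (∀ (g : A) (X : Fin k → TangentSpace IA g),
      mfderiv IA IM 𝒢.tgt g (K g X) = KM (𝒢.tgt g) fun i => mfderiv IA IM 𝒢.tgt g (X i)) ∧
    ∀ (g h : A) (X : Fin k → TangentSpace IA g) (Y : Fin k → TangentSpace IA h),
      𝒢.src g = 𝒢.tgt h → (∀ i, 𝒢.TangentComposable g h (X i) (Y i)) →
      K (𝒢.mulExt (g, h)) (fun i => 𝒢.tangentMul g h (X i) (Y i)) =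
        𝒢.tangentMul g h (K g X) (K h Y)

end LieGroupoid

end LieGroupoids

/-! ### Principal bundles and principal connections -/

section Principal

variable {EM HM EG HG EP HP : Type*}
  [NormedAddCommGroup EM] [NormedSpace ℝ EM] [TopologicalSpace HM]
  [NormedAddCommGroup EG] [NormedSpace ℝ EG] [TopologicalSpace HG]
  [NormedAddCommGroup EP] [NormedSpace ℝ EP] [TopologicalSpace HP]
  (IM : ModelWithCorners ℝ EM HM) (IG : ModelWithCorners ℝ EG HG) (IP : ModelWithCorners ℝ EP HP)
  (M G P : Type*)
  [TopologicalSpace M] [ChartedSpace HM M] [TopologicalSpace P] [ChartedSpace HP P]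
  [TopologicalSpace G] [ChartedSpace HG G] [Group G] [MulAction Gᵐᵒᵖ P]

variable {M G P} in
/-- A local trivialization `P|_U ≃ U × G` is principal if it is a diffeomorphism which
intertwines the right action of `G` on `P` with right multiplication in `G`. -/
structure IsPrincipalTrivialization {pr : P → M} (e : Trivialization G pr) : Prop where
  contMDiffOn : ContMDiffOn IP (IM.prod IG) ∞ e e.source
  contMDiffOn_symm : ContMDiffOn (IM.prod IG) IP ∞ e.toOpenPartialHomeomorph.symm e.target
  map_act : ∀ p ∈ e.source, ∀ g : G, (e (MulOpposite.op g • p)).2 = (e p).2 * g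

/-- A (right) principal `G`-bundle `P → M`; the right action is `(p, g) ↦ MulOpposite.op g • p`. -/
structure PrincipalBundle where
  proj : P → M
  contMDiff_act : ContMDiff (IP.prod IG) IP ∞ fun x : P × G => MulOpposite.op x.2 • x.1
  proj_act : ∀ (p : P) (g : G), proj (MulOpposite.op g • p) = proj p
  exists_trivialization : ∀ x : M, ∃ e : Trivialization G proj,
    x ∈ e.baseSet ∧ IsPrincipalTrivialization IM IG IP e

variable {IM IG IP M G P}

namespace PrincipalBundle

/-- The infinitesimal generator `u_P` of the action, at the point `p`, for `u` in the Lie algebra. -/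
def generator (_B : PrincipalBundle IM IG IP M G P) (u : GroupLieAlgebra IG G) (p : P) :
    TangentSpace IP p :=
  (mfderiv IG IP (fun g : G => MulOpposite.op g • p) 1 u : EP)

/-- A principal connection: a smooth one-form `θ` on `P` with values in the Lie algebra of `G`
such that `θ(u_P) = u` and `ψ_g^* θ = Ad_{g⁻¹} θ`. -/
structure Connection [IsManifold IP ∞ P] (B : PrincipalBundle IM IG IP M G P) where
  toFun : ∀ p : P, TangentSpace IP p →L[ℝ] GroupLieAlgebra IG G
  smooth' : ∀ U : Set P, IsOpen U → ∀ X : ∀ p : P, TangentSpace IP p, SmoothFieldOn IP P X U →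
    ContMDiffOn (M' := EG) IP 𝓘(ℝ, EG) ∞ (fun p => toFun p (X p)) U
  map_generator : ∀ (u : GroupLieAlgebra IG G) (p : P), toFun p (B.generator u p) = u
  map_act : ∀ (g : G) (p : P) (X : TangentSpace IP p),
    (toFun (MulOpposite.op g • p) (mfderiv IP IP (fun q : P => MulOpposite.op g • q) p X) : EG) =
      (mfderiv IG IG (fun h : G => g⁻¹ * h * g) 1 (toFun p X) : EG)


/-! ### The gauge groupoid -/

section Basic

variable (B : PrincipalBundle IM IG IP M G P)

theorem eq_of_trivialization {e : Trivialization G B.proj} {p q : P} (h : B.proj p = B.proj q)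
    (hp : B.proj p ∈ e.baseSet) (h' : (e p).2 = (e q).2) : p = q :=
  e.injOn (e.mem_source.2 hp) (e.mem_source.2 (h ▸ hp))
    (Prod.ext ((e.coe_fst' hp).trans (h.trans (e.coe_fst' (h ▸ hp)).symm)) h')

theorem exists_act_eq {p q : P} (h : B.proj p = B.proj q) :
    ∃ g : G, q = MulOpposite.op g • p := by
  obtain ⟨e, hx, he⟩ := B.exists_trivialization (B.proj p)
  have hp : p ∈ e.source := e.mem_source.2 hx
  refine ⟨(e p).2⁻¹ * (e q).2, (B.eq_of_trivialization (e := e) ?_ ?_ ?_).symm⟩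
  · rw [B.proj_act, h]
  · rwa [B.proj_act]
  · rw [he.map_act p hp]; group

theorem act_injective (B : PrincipalBundle IM IG IP M G P) (p : P) : Injective fun g : G => MulOpposite.op g • p := by
  intro g h hgh
  obtain ⟨e, hx, he⟩ := B.exists_trivialization (B.proj p)
  have hp : p ∈ e.source := e.mem_source.2 hx
  have := congrArg (fun q => (e q).2) hgh
  simpa [he.map_act p hp] using this

theorem contMDiff_proj : ContMDiff IP IM ∞ B.proj := by
  intro p
  obtain ⟨e, hx, he⟩ := B.exists_trivialization (B.proj p)
  have hp : p ∈ e.source := e.mem_source.2 hx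
  have h := contMDiffAt_fst.comp p ((he.contMDiffOn p hp).contMDiffAt (e.open_source.mem_nhds hp))
  exact h.congr_of_eventuallyEq
    (Filter.eventuallyEq_of_mem (e.open_source.mem_nhds hp) fun q hq => (e.coe_fst hq).symm)

theorem surjective_mfderiv_proj (p : P) : Surjective (mfderiv IP IM B.proj p) := by
  obtain ⟨e, hx, he⟩ := B.exists_trivialization (B.proj p)
  have hp : p ∈ e.source := e.mem_source.2 hx
  have ht : (B.proj p, (e p).2) ∈ e.target := e.mem_target.2 hx
  set f : M → P := fun x => e.toOpenPartialHomeomorph.symm (x, (e p).2) with hf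
  have hfp : f (B.proj p) = p := e.symm_apply_mk_proj hp
  have h1 : ContMDiffAt IM IP ∞ f (B.proj p) :=
    ContMDiffAt.comp (B.proj p) (g := e.toOpenPartialHomeomorph.symm) (f := fun x => (x, (e p).2))
      ((he.contMDiffOn_symm _ ht).contMDiffAt (e.open_target.mem_nhds ht))
      (contMDiffAt_id.prodMk contMDiffAt_const)
  have h2 : B.proj ∘ f =ᶠ[𝓝 (B.proj p)] id :=
    Filter.eventuallyEq_of_mem (e.open_baseSet.mem_nhds hx) fun x hx' => e.proj_symm_apply' hx'
  have h3 : HasMFDerivAt IM IM (B.proj ∘ f) (B.proj p)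
      ((mfderiv IP IM B.proj (f (B.proj p))).comp (mfderiv IM IP f (B.proj p))) :=
    HasMFDerivAt.comp _ ((B.contMDiff_proj _).mdifferentiableAt (by simp)).hasMFDerivAt
      (h1.mdifferentiableAt (by simp)).hasMFDerivAt
  have h4 := hasMFDerivAt_unique h3 ((hasMFDerivAt_id (B.proj p)).congr_of_eventuallyEq h2)
  intro v
  rw [← hfp]
  refine ⟨mfderiv IM IP f (B.proj p) v, ?_⟩
  exact DFunLike.congr_fun h4 v

end Basic

/-- The space of arrows `(P × P) / G` of the gauge groupoid, with the quotient topology. -/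
def GaugeSpace (_B : PrincipalBundle IM IG IP M G P) : Type _ :=
  MulAction.orbitRel.Quotient Gᵐᵒᵖ (P × P)

variable (B : PrincipalBundle IM IG IP M G P)

instance : TopologicalSpace B.GaugeSpace :=
  inferInstanceAs (TopologicalSpace (Quotient (MulAction.orbitRel Gᵐᵒᵖ (P × P))))

/-- The class of `(p, q)` in `(P × P) / G`. -/
def arrow (z : P × P) : B.GaugeSpace := Quotient.mk (MulAction.orbitRel Gᵐᵒᵖ (P × P)) z

theorem arrow_surjective : Surjective B.arrow := Quotient.mk_surjective

theorem arrow_eq_arrow {z w : P × P} :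
    B.arrow z = B.arrow w ↔ ∃ g : G, z = (MulOpposite.op g • w.1, MulOpposite.op g • w.2) := by
  refine Quotient.eq.trans ⟨?_, ?_⟩
  · rintro ⟨g, rfl⟩
    exact ⟨g.unop, rfl⟩
  · rintro ⟨g, rfl⟩
    exact ⟨MulOpposite.op g, rfl⟩

theorem arrow_act (g : G) (z : P × P) :
    B.arrow (MulOpposite.op g • z.1, MulOpposite.op g • z.2) = B.arrow z := B.arrow_eq_arrow.2 ⟨g, rfl⟩

theorem continuous_arrow : Continuous B.arrow := continuous_quot_mk

theorem isOpenQuotientMap_arrow : IsOpenQuotientMap B.arrow := by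
  have : ContinuousConstSMul Gᵐᵒᵖ (P × P) := by
    refine ⟨fun g => ?_⟩
    have h : Continuous fun p : P => MulOpposite.op g.unop • p :=
      B.contMDiff_act.continuous.comp (continuous_id.prodMk continuous_const)
    exact (h.comp continuous_fst).prodMk (h.comp continuous_snd)
  exact ⟨B.arrow_surjective, B.continuous_arrow, isOpenMap_quotient_mk'_mul⟩

/-- The source map `(p, q) ↦ π(q)`. -/
def gaugeSrc : B.GaugeSpace → M :=
  Quotient.lift (fun z : P × P => B.proj z.2) (by rintro _ w ⟨g, rfl⟩; exact B.proj_act w.2 g.unop)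

/-- The target map `(p, q) ↦ π(p)`. -/
def gaugeTgt : B.GaugeSpace → M :=
  Quotient.lift (fun z : P × P => B.proj z.1) (by rintro _ w ⟨g, rfl⟩; exact B.proj_act w.1 g.unop)

@[simp] theorem gaugeSrc_arrow (z : P × P) : B.gaugeSrc (B.arrow z) = B.proj z.2 := rfl
@[simp] theorem gaugeTgt_arrow (z : P × P) : B.gaugeTgt (B.arrow z) = B.proj z.1 := rfl

theorem continuous_gaugeSrc : Continuous B.gaugeSrc :=
  (B.contMDiff_proj.continuous.comp continuous_snd).quotient_lift _

theorem continuous_gaugeTgt : Continuous B.gaugeTgt :=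
  (B.contMDiff_proj.continuous.comp continuous_fst).quotient_lift _

theorem proj_surjective : Surjective B.proj := by
  intro x
  obtain ⟨e, hx, -⟩ := B.exists_trivialization x
  exact ⟨_, e.proj_symm_apply' (x := 1) hx⟩

/-- The unit `x ↦ [(p, p)]`, where `p` is any point over `x`. -/
def gaugeUnit (x : M) : B.GaugeSpace :=
  B.arrow ((B.proj_surjective x).choose, (B.proj_surjective x).choose)

theorem gaugeUnit_proj (p : P) : B.gaugeUnit (B.proj p) = B.arrow (p, p) := by
  obtain ⟨g, hg⟩ := B.exists_act_eq (B.proj_surjective (B.proj p)).choose_spec.symm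
  rw [gaugeUnit, hg]
  exact B.arrow_act g (p, p)

/-- The inversion `[(p, q)] ↦ [(q, p)]`. -/
def gaugeInv : B.GaugeSpace → B.GaugeSpace :=
  Quotient.lift (fun z : P × P => B.arrow (z.2, z.1))
    (by rintro _ w ⟨g, rfl⟩; exact B.arrow_act g.unop (w.2, w.1))

@[simp] theorem gaugeInv_arrow (z : P × P) : B.gaugeInv (B.arrow z) = B.arrow (z.2, z.1) := rfl

theorem exists_act_out {g h : B.GaugeSpace} (c : B.gaugeSrc g = B.gaugeTgt h) :
    ∃ a : G, (Quotient.out g).2 = MulOpposite.op a • (Quotient.out h).1 := by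
  refine B.exists_act_eq ?_
  have hg : B.arrow (Quotient.out g) = g := Quotient.out_eq g
  have hh : B.arrow (Quotient.out h) = h := Quotient.out_eq h
  rw [← hg, ← hh] at c
  exact c.symm

/-- The multiplication `[(p, q)] [(q', r)] = [(p, r a)]`, where `q = q' a` with `a` in `G`. -/
def gaugeMul (g h : B.GaugeSpace) (c : B.gaugeSrc g = B.gaugeTgt h) : B.GaugeSpace :=
  B.arrow ((Quotient.out g).1, MulOpposite.op (B.exists_act_out c).choose • (Quotient.out h).2)

theorem gaugeMul_arrow (p q r : P) :
    B.gaugeMul (B.arrow (p, q)) (B.arrow (q, r)) rfl = B.arrow (p, r) := by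
  set z := Quotient.out (B.arrow (p, q)) with hz
  set w := Quotient.out (B.arrow (q, r)) with hw
  obtain ⟨b, hb⟩ := B.arrow_eq_arrow.1 (show B.arrow z = B.arrow (p, q) from Quotient.out_eq _)
  obtain ⟨d, hd⟩ := B.arrow_eq_arrow.1 (show B.arrow w = B.arrow (q, r) from Quotient.out_eq _)
  have ha := (B.exists_act_out (g := B.arrow (p, q)) (h := B.arrow (q, r)) rfl).choose_spec
  set a := (B.exists_act_out (g := B.arrow (p, q)) (h := B.arrow (q, r)) rfl).choose
  rw [← hz, ← hw, hb, hd] at ha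
  change B.arrow (z.1, MulOpposite.op a • w.2) = _
  rw [hb, hd]
  simp only [smul_smul, ← MulOpposite.op_mul] at ha ⊢
  rw [← B.act_injective q ha]
  exact B.arrow_act b (p, r)

theorem exists_arrow_eq {g h : B.GaugeSpace} (c : B.gaugeSrc g = B.gaugeTgt h) (z : P × P)
    (hz : B.arrow z = g) : ∃ r : P, h = B.arrow (z.2, r) := by
  obtain ⟨w, rfl⟩ := B.arrow_surjective h
  subst hz
  obtain ⟨a, ha⟩ := B.exists_act_eq (p := w.1) (q := z.2) c.symm
  exact ⟨MulOpposite.op a • w.2, ha ▸ (B.arrow_act a w).symm⟩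

/-- The gauge groupoid `(P × P) / G ⇉ M`, as a groupoid. -/
def gaugeGroupoidOver : GroupoidOver B.GaugeSpace M where
  src := B.gaugeSrc
  tgt := B.gaugeTgt
  unit := B.gaugeUnit
  inv := B.gaugeInv
  mul := B.gaugeMul
  src_unit x := (B.proj_surjective x).choose_spec
  tgt_unit x := (B.proj_surjective x).choose_spec
  src_inv g := by obtain ⟨z, rfl⟩ := B.arrow_surjective g; rfl
  tgt_inv g := by obtain ⟨z, rfl⟩ := B.arrow_surjective g; rfl
  src_mul g h c := by
    obtain ⟨z, rfl⟩ := B.arrow_surjective g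
    obtain ⟨r, rfl⟩ := B.exists_arrow_eq c z rfl
    exact (congrArg B.gaugeSrc (B.gaugeMul_arrow z.1 z.2 r) :)
  tgt_mul g h c := by
    obtain ⟨z, rfl⟩ := B.arrow_surjective g
    obtain ⟨r, rfl⟩ := B.exists_arrow_eq c z rfl
    exact (congrArg B.gaugeTgt (B.gaugeMul_arrow z.1 z.2 r) :)
  mul_assoc g h k c d := by
    obtain ⟨⟨p, q⟩, rfl⟩ := B.arrow_surjective g
    obtain ⟨r, rfl⟩ := B.exists_arrow_eq c (p, q) rfl
    obtain ⟨s, rfl⟩ := B.exists_arrow_eq d (q, r) rfl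
    simp only [B.gaugeMul_arrow]
  unit_mul g := by
    obtain ⟨⟨p, q⟩, rfl⟩ := B.arrow_surjective g
    simp only [B.gaugeTgt_arrow, B.gaugeUnit_proj, B.gaugeMul_arrow]
  mul_unit g := by
    obtain ⟨⟨p, q⟩, rfl⟩ := B.arrow_surjective g
    simp only [B.gaugeSrc_arrow, B.gaugeUnit_proj, B.gaugeMul_arrow]
  inv_mul g := by
    obtain ⟨⟨p, q⟩, rfl⟩ := B.arrow_surjective g
    simp only [B.gaugeSrc_arrow, B.gaugeInv_arrow, B.gaugeUnit_proj, B.gaugeMul_arrow]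
  mul_inv g := by
    obtain ⟨⟨p, q⟩, rfl⟩ := B.arrow_surjective g
    simp only [B.gaugeTgt_arrow, B.gaugeInv_arrow, B.gaugeUnit_proj, B.gaugeMul_arrow]

section Charts

variable {B}
variable {e e' : Trivialization G B.proj}

/-- The map `(p, q) ↦ (π(p), γ(p) γ'(q)⁻¹, π(q))`, where `γ` and `γ'` are the components in `G` of
two principal trivializations. -/
def locTriv (e e' : Trivialization G B.proj) (z : P × P) : M × G × M :=
  (B.proj z.1, (e z.1).2 * (e' z.2).2⁻¹, B.proj z.2)

/-- The local section of `P × P → (P × P) / G` given by two principal trivializations. -/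
def locSec (e e' : Trivialization G B.proj) (y : M × G × M) : P × P :=
  (e.toOpenPartialHomeomorph.symm (y.1, y.2.1), e'.toOpenPartialHomeomorph.symm (y.2.2, 1))

theorem locTriv_out
    (he : IsPrincipalTrivialization IM IG IP e) (he' : IsPrincipalTrivialization IM IG IP e')
    {z : P × P} (h1 : B.proj z.1 ∈ e.baseSet) (h2 : B.proj z.2 ∈ e'.baseSet) :
    locTriv e e' (Quotient.out (B.arrow z)) = locTriv e e' z := by
  obtain ⟨g, hg⟩ := B.arrow_eq_arrow.1 (show B.arrow (Quotient.out (B.arrow z)) = B.arrow z from Quotient.out_eq _)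
  rw [hg]
  simp only [locTriv, B.proj_act, he.map_act _ (e.mem_source.2 h1),
    he'.map_act _ (e'.mem_source.2 h2)]
  refine Prod.ext rfl (Prod.ext ?_ rfl)
  simp only
  group

theorem locTriv_locSec {y : M × G × M} (h1 : y.1 ∈ e.baseSet) (h2 : y.2.2 ∈ e'.baseSet) :
    locTriv e e' (locSec e e' y) = y := by
  simp only [locTriv, locSec]
  rw [e.proj_symm_apply' h1, e'.proj_symm_apply' h2, e.apply_symm_apply' h1,
    e'.apply_symm_apply' h2]
  simp

theorem proj_locSec_fst {y : M × G × M} (h1 : y.1 ∈ e.baseSet) :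
    B.proj (locSec e e' y).1 = y.1 := e.proj_symm_apply' h1

theorem proj_locSec_snd {y : M × G × M} (h2 : y.2.2 ∈ e'.baseSet) :
    B.proj (locSec e e' y).2 = y.2.2 := e'.proj_symm_apply' h2

theorem arrow_locSec_locTriv
    (he : IsPrincipalTrivialization IM IG IP e) (he' : IsPrincipalTrivialization IM IG IP e')
    {z : P × P} (h1 : B.proj z.1 ∈ e.baseSet)
    (h2 : B.proj z.2 ∈ e'.baseSet) : B.arrow (locSec e e' (locTriv e e' z)) = B.arrow z := by
  refine B.arrow_eq_arrow.2 ⟨(e' z.2).2⁻¹, Prod.ext ?_ ?_⟩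
  · refine B.eq_of_trivialization (e := e) ?_ ?_ ?_
    · rw [B.proj_act]; exact proj_locSec_fst (e' := e') (y := locTriv e e' z) h1
    · rwa [proj_locSec_fst (e' := e') (y := locTriv e e' z) h1]
    · rw [he.map_act _ (e.mem_source.2 h1)]
      exact congrArg Prod.snd (e.apply_symm_apply' h1)
  · refine B.eq_of_trivialization (e := e') ?_ ?_ ?_
    · rw [B.proj_act]; exact proj_locSec_snd (e := e) (y := locTriv e e' z) h2
    · rwa [proj_locSec_snd (e := e) (y := locTriv e e' z) h2]
    · rw [he'.map_act _ (e'.mem_source.2 h2), mul_inv_cancel]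
      exact congrArg Prod.snd (e'.apply_symm_apply' h2)

/-- The open set of pairs on which both trivializations are defined. -/
def locDom (e e' : Trivialization G B.proj) : Set (P × P) :=
  {z | B.proj z.1 ∈ e.baseSet ∧ B.proj z.2 ∈ e'.baseSet}

theorem isOpen_locDom : IsOpen (locDom e e') :=
  (e.open_baseSet.preimage (B.contMDiff_proj.continuous.comp continuous_fst)).inter
    (e'.open_baseSet.preimage (B.contMDiff_proj.continuous.comp continuous_snd))

theorem isOpen_locTgt : IsOpen {y : M × G × M | y.1 ∈ e.baseSet ∧ y.2.2 ∈ e'.baseSet} :=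
  (e.open_baseSet.preimage continuous_fst).inter
    (e'.open_baseSet.preimage (continuous_snd.comp continuous_snd))

theorem contMDiffOn_locTriv [LieGroup IG ∞ G]
    (he : IsPrincipalTrivialization IM IG IP e) (he' : IsPrincipalTrivialization IM IG IP e') :
    ContMDiffOn (IP.prod IP) (IM.prod (IG.prod IM)) ∞ (locTriv e e') (locDom e e') := by
  have h1 : ContMDiffOn (IP.prod IP) (IM.prod IG) ∞ (fun z : P × P => e z.1) (locDom e e') :=
    he.contMDiffOn.comp contMDiffOn_fst fun z hz => e.mem_source.2 hz.1
  have h2 : ContMDiffOn (IP.prod IP) (IM.prod IG) ∞ (fun z : P × P => e' z.2) (locDom e e') :=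
    he'.contMDiffOn.comp contMDiffOn_snd fun z hz => e'.mem_source.2 hz.2
  refine (B.contMDiff_proj.comp_contMDiffOn contMDiffOn_fst).prodMk (ContMDiffOn.prodMk ?_
    (B.contMDiff_proj.comp_contMDiffOn contMDiffOn_snd))
  exact (contMDiff_snd.comp_contMDiffOn h1).mul (contMDiff_snd.comp_contMDiffOn h2).inv

theorem contMDiffOn_locSec
    (he : IsPrincipalTrivialization IM IG IP e) (he' : IsPrincipalTrivialization IM IG IP e') :
    ContMDiffOn (IM.prod (IG.prod IM)) (IP.prod IP) ∞ (locSec e e')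
      {y | y.1 ∈ e.baseSet ∧ y.2.2 ∈ e'.baseSet} := by
  refine ContMDiffOn.prodMk (he.contMDiffOn_symm.comp (t := e.target)
    (contMDiffOn_fst.prodMk (contMDiff_fst.comp_contMDiffOn contMDiffOn_snd))
    fun y hy => e.mem_target.2 hy.1)
    (he'.contMDiffOn_symm.comp (t := e'.target)
    ((contMDiff_snd.comp_contMDiffOn contMDiffOn_snd).prodMk contMDiffOn_const)
    fun y hy => e'.mem_target.2 hy.2)

/-- The local trivialization `(p, q) ↦ (π(p), γ(p) γ'(q)⁻¹, π(q))` of `(P × P) / G`. -/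
def gaugeTriv [LieGroup IG ∞ G] (e e' : Trivialization G B.proj)
    (he : IsPrincipalTrivialization IM IG IP e) (he' : IsPrincipalTrivialization IM IG IP e') :
    OpenPartialHomeomorph B.GaugeSpace (M × G × M) where
  toFun c := locTriv e e' (Quotient.out c)
  invFun y := B.arrow (locSec e e' y)
  source := {c | B.gaugeTgt c ∈ e.baseSet ∧ B.gaugeSrc c ∈ e'.baseSet}
  target := {y | y.1 ∈ e.baseSet ∧ y.2.2 ∈ e'.baseSet}
  map_source' c hc := by
    obtain ⟨z, rfl⟩ := B.arrow_surjective c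
    rw [locTriv_out he he' hc.1 hc.2]
    exact hc
  map_target' y hy :=
    ⟨by simpa [proj_locSec_fst (e' := e') hy.1] using hy.1,
      by simpa [proj_locSec_snd (e := e) hy.2] using hy.2⟩
  left_inv' c hc := by
    obtain ⟨z, rfl⟩ := B.arrow_surjective c
    rw [locTriv_out he he' hc.1 hc.2, arrow_locSec_locTriv he he' hc.1 hc.2]
  right_inv' y hy := by
    rw [locTriv_out he he' ((proj_locSec_fst (e' := e') hy.1).symm ▸ hy.1)
      ((proj_locSec_snd (e := e) hy.2).symm ▸ hy.2), locTriv_locSec hy.1 hy.2]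
  open_source := (e.open_baseSet.preimage B.continuous_gaugeTgt).inter
    (e'.open_baseSet.preimage B.continuous_gaugeSrc)
  open_target := isOpen_locTgt
  continuousOn_toFun := by
    intro c hc
    obtain ⟨z, rfl⟩ := B.arrow_surjective c
    refine ContinuousAt.continuousWithinAt (B.isOpenQuotientMap_arrow.continuousAt_comp_iff.1 ?_)
    have hz : locDom e e' ∈ 𝓝 z := isOpen_locDom.mem_nhds hc
    refine (((contMDiffOn_locTriv he he').continuousOn.continuousAt hz)).congr
      (Filter.eventuallyEq_of_mem hz fun w hw => ?_)
    exact (locTriv_out he he' hw.1 hw.2).symm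
  continuousOn_invFun := B.continuous_arrow.comp_continuousOn (contMDiffOn_locSec he he').continuousOn

end Charts

variable [LieGroup IG ∞ G]

/-- The smooth atlas of `(P × P) / G`, modelled on `M × G × M`. -/
instance : ChartedSpace (ModelProd HM (ModelProd HG HM)) B.GaugeSpace where
  atlas := {f | ∃ (e e' : Trivialization G B.proj) (he : IsPrincipalTrivialization IM IG IP e)
    (he' : IsPrincipalTrivialization IM IG IP e') (y : M × G × M),
    f = (gaugeTriv e e' he he').trans (chartAt (ModelProd HM (ModelProd HG HM)) y)}
  chartAt c := (gaugeTriv _ _ (B.exists_trivialization (B.gaugeTgt c)).choose_spec.2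
    (B.exists_trivialization (B.gaugeSrc c)).choose_spec.2).trans
      (chartAt (ModelProd HM (ModelProd HG HM)) (gaugeTriv _ _
        (B.exists_trivialization (B.gaugeTgt c)).choose_spec.2
        (B.exists_trivialization (B.gaugeSrc c)).choose_spec.2 c))
  mem_chart_source c := by
    rw [OpenPartialHomeomorph.trans_source]
    exact ⟨⟨(B.exists_trivialization (B.gaugeTgt c)).choose_spec.1,
      (B.exists_trivialization (B.gaugeSrc c)).choose_spec.1⟩, mem_chart_source (ModelProd HM (ModelProd HG HM)) (_ : M × G × M)⟩
  chart_mem_atlas c := ⟨_, _, _, _, _, rfl⟩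

variable {B} in
theorem gaugeTriv_arrow {e e' : Trivialization G B.proj} (he : IsPrincipalTrivialization IM IG IP e)
    (he' : IsPrincipalTrivialization IM IG IP e') {z : P × P} (hz : z ∈ locDom e e') :
    gaugeTriv e e' he he' (B.arrow z) = locTriv e e' z := locTriv_out he he' hz.1 hz.2

variable [IsManifold IM ∞ M]

/-- The transition maps of this atlas are smooth. -/
instance : IsManifold (IM.prod (IG.prod IM)) ∞ B.GaugeSpace := by
  refine isManifold_of_contDiffOn _ _ _ ?_
  rintro _ _ ⟨e₁, e₁', he₁, he₁', y₁, rfl⟩ ⟨e₂, e₂', he₂, he₂', y₂, rfl⟩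
  rw [← contMDiffOn_iff_contDiffOn]
  set I := IM.prod (IG.prod IM)
  have hI1 : ContMDiff I 𝓘(ℝ, _) ∞ I := I.contMDiff
  have hI2 := I.contMDiffOn_symm (n := ∞)
  have hc1 : ContMDiffOn I I ∞ (chartAt (ModelProd HM (ModelProd HG HM)) y₁).symm _ :=
    contMDiffOn_chart_symm
  have hc2 : ContMDiffOn I I ∞ (chartAt (ModelProd HM (ModelProd HG HM)) y₂) _ :=
    contMDiffOn_chart
  have hs := contMDiffOn_locSec he₁ he₁'
  have ht := contMDiffOn_locTriv he₂ he₂'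
  have key := hI1.comp_contMDiffOn (hc2.comp' (ht.comp' (hs.comp' (hc1.comp' hI2))))
  refine (key.mono ?_).congr ?_
  · rintro x ⟨hx, hx'⟩
    simp only [mfld_simps] at hx
    obtain ⟨⟨h1, h2⟩, h3, h4⟩ := hx
    have h5 := gaugeTriv_arrow he₂ he₂' (z := locSec e₁ e₁' ((chartAt _ y₁).symm (I.symm x))) h3
    refine ⟨⟨⟨⟨hx', h1⟩, h2⟩, h3⟩, ?_⟩
    exact (congrArg (fun y => y ∈ (chartAt (ModelProd HM (ModelProd HG HM)) y₂).source) h5).mp h4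
  · rintro x ⟨hx, hx'⟩
    simp only [mfld_simps] at hx
    obtain ⟨⟨h1, h2⟩, h3, h4⟩ := hx
    have h5 := gaugeTriv_arrow he₂ he₂' (z := locSec e₁ e₁' ((chartAt _ y₁).symm (I.symm x))) h3
    exact congrArg (fun y => I (chartAt (ModelProd HM (ModelProd HG HM)) y₂ y)) h5

section Smooth

variable {B} {e e' : Trivialization G B.proj} (he : IsPrincipalTrivialization IM IG IP e)
    (he' : IsPrincipalTrivialization IM IG IP e')

theorem contMDiffOn_gaugeTriv :
    ContMDiffOn (IM.prod (IG.prod IM)) (IM.prod (IG.prod IM)) ∞ (gaugeTriv e e' he he')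
      (gaugeTriv e e' he he').source := by
  intro c hc
  set y := gaugeTriv e e' he he' c with hy
  set ψ := (gaugeTriv e e' he he').trans (chartAt (ModelProd HM (ModelProd HG HM)) y) with hψ
  have hm : ψ ∈ IsManifold.maximalAtlas (IM.prod (IG.prod IM)) ∞ B.GaugeSpace :=
    IsManifold.subset_maximalAtlas ⟨e, e', he, he', y, rfl⟩
  have h1 := contMDiffOn_of_mem_maximalAtlas hm
  have h2 : ContMDiffOn (IM.prod (IG.prod IM)) (IM.prod (IG.prod IM)) ∞
    (chartAt (ModelProd HM (ModelProd HG HM)) y).symm _ := contMDiffOn_chart_symm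
  have hcψ : c ∈ ψ.source := by
    rw [hψ, OpenPartialHomeomorph.trans_source]
    exact ⟨hc, mem_chart_source (ModelProd HM (ModelProd HG HM)) y⟩
  refine ContMDiffAt.contMDiffWithinAt ?_
  have h3 := (h2.comp' h1).contMDiffAt (x := c) (Filter.inter_mem (ψ.open_source.mem_nhds hcψ)
    (Filter.mem_of_superset (ψ.open_source.mem_nhds hcψ) fun d hd => ?_))
  · refine h3.congr_of_eventuallyEq (Filter.eventuallyEq_of_mem (ψ.open_source.mem_nhds hcψ) ?_)
    intro d hd
    rw [hψ, OpenPartialHomeomorph.trans_source] at hd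
    exact ((chartAt (ModelProd HM (ModelProd HG HM)) y).left_inv hd.2).symm
  · rw [hψ, OpenPartialHomeomorph.trans_source] at hd
    exact (chartAt (ModelProd HM (ModelProd HG HM)) y).map_source hd.2

theorem contMDiffOn_gaugeTriv_symm :
    ContMDiffOn (IM.prod (IG.prod IM)) (IM.prod (IG.prod IM)) ∞ (gaugeTriv e e' he he').symm
      (gaugeTriv e e' he he').target := by
  intro y hy
  set ψ := (gaugeTriv e e' he he').trans (chartAt (ModelProd HM (ModelProd HG HM)) y) with hψ
  have hm : ψ ∈ IsManifold.maximalAtlas (IM.prod (IG.prod IM)) ∞ B.GaugeSpace :=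
    IsManifold.subset_maximalAtlas ⟨e, e', he, he', y, rfl⟩
  have h1 := contMDiffOn_symm_of_mem_maximalAtlas hm
  have h2 : ContMDiffOn (IM.prod (IG.prod IM)) (IM.prod (IG.prod IM)) ∞
    (chartAt (ModelProd HM (ModelProd HG HM)) y) _ := contMDiffOn_chart
  set S := (gaugeTriv e e' he he').target ∩ (chartAt (ModelProd HM (ModelProd HG HM)) y).source
  have hS : S ∈ 𝓝 y := Filter.inter_mem ((gaugeTriv e e' he he').open_target.mem_nhds hy)
    (chart_source_mem_nhds _ _)
  refine ContMDiffAt.contMDiffWithinAt ?_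
  have h3 := (h1.comp' h2).contMDiffAt (x := y) (Filter.mem_of_superset hS fun d hd => ?_)
  · refine h3.congr_of_eventuallyEq (Filter.eventuallyEq_of_mem hS fun d hd => ?_)
    exact congrArg (gaugeTriv e e' he he').symm
      ((chartAt (ModelProd HM (ModelProd HG HM)) y).left_inv hd.2).symm
  · refine ⟨hd.2, ?_⟩
    rw [mem_preimage, hψ, OpenPartialHomeomorph.trans_target]
    refine ⟨(chartAt (ModelProd HM (ModelProd HG HM)) y).map_source hd.2, ?_⟩
    rw [mem_preimage, (chartAt (ModelProd HM (ModelProd HG HM)) y).left_inv hd.2]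
    exact hd.1

end Smooth

theorem contMDiff_arrow : ContMDiff (IP.prod IP) (IM.prod (IG.prod IM)) ∞ B.arrow := by
  intro z
  obtain ⟨e, h1, he⟩ := B.exists_trivialization (B.proj z.1)
  obtain ⟨e', h2, he'⟩ := B.exists_trivialization (B.proj z.2)
  have hz : locDom e e' ∈ 𝓝 z := isOpen_locDom.mem_nhds ⟨h1, h2⟩
  have h := ((contMDiffOn_gaugeTriv_symm he he').comp (contMDiffOn_locTriv he he')
    fun w hw => hw).contMDiffAt hz
  exact h.congr_of_eventuallyEq (Filter.eventuallyEq_of_mem hz fun w hw =>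
    (arrow_locSec_locTriv he he' hw.1 hw.2).symm)

/-- Near every point, the quotient map `P × P → (P × P) / G` has a smooth section. -/
theorem exists_section (c : B.GaugeSpace) : ∃ σ : B.GaugeSpace → P × P,
    ContMDiffAt (IM.prod (IG.prod IM)) (IP.prod IP) ∞ σ c ∧ ∀ᶠ d in 𝓝 c, B.arrow (σ d) = d := by
  obtain ⟨e, h1, he⟩ := B.exists_trivialization (B.gaugeTgt c)
  obtain ⟨e', h2, he'⟩ := B.exists_trivialization (B.gaugeSrc c)
  have hc : (gaugeTriv e e' he he').source ∈ 𝓝 c :=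
    (gaugeTriv e e' he he').open_source.mem_nhds ⟨h1, h2⟩
  refine ⟨locSec e e' ∘ gaugeTriv e e' he he', ?_, Filter.eventually_of_mem hc fun d hd =>
    (gaugeTriv e e' he he').left_inv hd⟩
  exact ((contMDiffOn_locSec he he').comp (contMDiffOn_gaugeTriv he he')
    fun d hd => (gaugeTriv e e' he he').map_source hd).contMDiffAt hc

variable {B} in
/-- A map on `(P × P) / G` is smooth if it is smooth as a map on `P × P`. -/
theorem contMDiff_of_comp_arrow {EN HN N : Type*} [NormedAddCommGroup EN] [NormedSpace ℝ EN]
    [TopologicalSpace HN] {IN : ModelWithCorners ℝ EN HN} [TopologicalSpace N] [ChartedSpace HN N]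
    {f : B.GaugeSpace → N} (hf : ContMDiff (IP.prod IP) IN ∞ (f ∘ B.arrow)) :
    ContMDiff (IM.prod (IG.prod IM)) IN ∞ f := by
  intro c
  obtain ⟨σ, h1, h2⟩ := B.exists_section c
  refine ((hf _).comp c h1).congr_of_eventuallyEq ?_
  filter_upwards [h2] with d hd
  exact congrArg f hd.symm

theorem contMDiff_gaugeSrc : ContMDiff (IM.prod (IG.prod IM)) IM ∞ B.gaugeSrc :=
  contMDiff_of_comp_arrow (B.contMDiff_proj.comp contMDiff_snd)

theorem contMDiff_gaugeTgt : ContMDiff (IM.prod (IG.prod IM)) IM ∞ B.gaugeTgt :=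
  contMDiff_of_comp_arrow (B.contMDiff_proj.comp contMDiff_fst)

theorem submersion_gaugeSrc (c : B.GaugeSpace) :
    Surjective (mfderiv (IM.prod (IG.prod IM)) IM B.gaugeSrc c) := by
  obtain ⟨z, rfl⟩ := B.arrow_surjective c
  intro v
  obtain ⟨w, hw⟩ := B.surjective_mfderiv_proj z.2 v
  have h1 : HasMFDerivAt (IP.prod IP) IM (B.gaugeSrc ∘ B.arrow) z _ :=
    HasMFDerivAt.comp z ((B.contMDiff_gaugeSrc _).mdifferentiableAt (by simp)).hasMFDerivAt
      ((B.contMDiff_arrow z).mdifferentiableAt (by simp)).hasMFDerivAt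
  have h2 : HasMFDerivAt (IP.prod IP) IM (B.proj ∘ Prod.snd) z _ :=
    HasMFDerivAt.comp z ((B.contMDiff_proj _).mdifferentiableAt (by simp)).hasMFDerivAt
      (hasMFDerivAt_snd z)
  have h3 := DFunLike.congr_fun (hasMFDerivAt_unique h1 h2) ((0, w) : EP × EP)
  exact ⟨_, h3.trans hw⟩

theorem submersion_gaugeTgt (c : B.GaugeSpace) :
    Surjective (mfderiv (IM.prod (IG.prod IM)) IM B.gaugeTgt c) := by
  obtain ⟨z, rfl⟩ := B.arrow_surjective c
  intro v
  obtain ⟨w, hw⟩ := B.surjective_mfderiv_proj z.1 v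
  have h1 : HasMFDerivAt (IP.prod IP) IM (B.gaugeTgt ∘ B.arrow) z _ :=
    HasMFDerivAt.comp z ((B.contMDiff_gaugeTgt _).mdifferentiableAt (by simp)).hasMFDerivAt
      ((B.contMDiff_arrow z).mdifferentiableAt (by simp)).hasMFDerivAt
  have h2 : HasMFDerivAt (IP.prod IP) IM (B.proj ∘ Prod.fst) z _ :=
    HasMFDerivAt.comp z ((B.contMDiff_proj _).mdifferentiableAt (by simp)).hasMFDerivAt
      (hasMFDerivAt_fst z)
  have h3 := DFunLike.congr_fun (hasMFDerivAt_unique h1 h2) ((w, 0) : EP × EP)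
  exact ⟨_, h3.trans hw⟩

theorem contMDiff_gaugeUnit : ContMDiff IM (IM.prod (IG.prod IM)) ∞ B.gaugeUnit := by
  intro x
  obtain ⟨e, hx, he⟩ := B.exists_trivialization x
  have hb := e.open_baseSet.mem_nhds hx
  have h1 : ContMDiffOn IM IP ∞ (fun y => e.toOpenPartialHomeomorph.symm (y, 1)) e.baseSet :=
    he.contMDiffOn_symm.comp (t := e.target) (contMDiffOn_id.prodMk contMDiffOn_const)
      fun y hy => e.mem_target.2 hy
  refine (((B.contMDiff_arrow).comp_contMDiffOn (h1.prodMk h1)).contMDiffAt hb).congr_of_eventuallyEq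
    (Filter.eventuallyEq_of_mem hb fun y hy => ?_)
  have h2 := B.gaugeUnit_proj (e.toOpenPartialHomeomorph.symm (y, 1))
  rwa [e.proj_symm_apply' hy] at h2

theorem contMDiffOn_gaugeMul :
    ContMDiffOn ((IM.prod (IG.prod IM)).prod (IM.prod (IG.prod IM))) (IM.prod (IG.prod IM)) ∞
      B.gaugeGroupoidOver.mulExt B.gaugeGroupoidOver.composable := by
  rintro ⟨g, h⟩ c
  have hgh : B.gaugeSrc g = B.gaugeTgt h := c
  obtain ⟨σ, hσ, hσ'⟩ := B.exists_section g
  obtain ⟨τ, hτ, hτ'⟩ := B.exists_section h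
  obtain ⟨e, hx, he⟩ := B.exists_trivialization (B.gaugeSrc g)
  have hq : (σ g).2 ∈ e.source := e.mem_source.2 (by
    rw [← B.gaugeSrc_arrow, hσ'.self_of_nhds]; exact hx)
  have hq' : (τ h).1 ∈ e.source := e.mem_source.2 (by
    rw [← B.gaugeTgt_arrow, hτ'.self_of_nhds, ← hgh]; exact hx)
  let J := IM.prod (IG.prod IM)
  have s1 : ContMDiffAt (J.prod J) (IP.prod IP) ∞
      (fun x : B.GaugeSpace × B.GaugeSpace => σ x.1) (g, h) :=
    ContMDiffAt.comp (g, h) (g := σ) (f := Prod.fst) hσ contMDiffAt_fst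
  have s2 : ContMDiffAt (J.prod J) (IP.prod IP) ∞
      (fun x : B.GaugeSpace × B.GaugeSpace => τ x.2) (g, h) :=
    ContMDiffAt.comp (g, h) (g := τ) (f := Prod.snd) hτ contMDiffAt_snd
  have s3 : ContMDiffAt (J.prod J) IP ∞
      (fun x : B.GaugeSpace × B.GaugeSpace => (σ x.1).2) (g, h) := contMDiffAt_snd.comp _ s1
  have s4 : ContMDiffAt (J.prod J) IP ∞
      (fun x : B.GaugeSpace × B.GaugeSpace => (τ x.2).1) (g, h) := contMDiffAt_fst.comp _ s2
  have s5 : ContMDiffAt (J.prod J) IG ∞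
      (fun x : B.GaugeSpace × B.GaugeSpace => (e (σ x.1).2).2) (g, h) :=
    contMDiffAt_snd.comp _ (ContMDiffAt.comp (g, h) (g := e)
      ((he.contMDiffOn _ hq).contMDiffAt (e.open_source.mem_nhds hq)) s3)
  have s6 : ContMDiffAt (J.prod J) IG ∞
      (fun x : B.GaugeSpace × B.GaugeSpace => (e (τ x.2).1).2) (g, h) :=
    contMDiffAt_snd.comp _ (ContMDiffAt.comp (g, h) (g := e)
      ((he.contMDiffOn _ hq').contMDiffAt (e.open_source.mem_nhds hq')) s4)
  have s7 : ContMDiffAt (J.prod J) J ∞ (fun x : B.GaugeSpace × B.GaugeSpace =>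
      B.arrow ((σ x.1).1, MulOpposite.op ((e (τ x.2).1).2⁻¹ * (e (σ x.1).2).2) • (τ x.2).2))
      (g, h) :=
    (B.contMDiff_arrow _).comp _ ((contMDiffAt_fst.comp _ s1).prodMk
      ((B.contMDiff_act _).comp _ ((contMDiffAt_snd.comp _ s2).prodMk (s6.inv.mul s5))))
  have n1 : ∀ᶠ x : B.GaugeSpace × B.GaugeSpace in 𝓝 (g, h), B.arrow (σ x.1) = x.1 :=
    (continuous_fst.tendsto (g, h)).eventually hσ'
  have n2 : ∀ᶠ x : B.GaugeSpace × B.GaugeSpace in 𝓝 (g, h), B.arrow (τ x.2) = x.2 :=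
    (continuous_snd.tendsto (g, h)).eventually hτ'
  have n3 : ∀ᶠ x : B.GaugeSpace × B.GaugeSpace in 𝓝 (g, h), B.proj (τ x.2).1 ∈ e.baseSet :=
    (B.contMDiff_proj.continuous.continuousAt.comp s4.continuousAt).eventually
      (e.open_baseSet.mem_nhds (e.mem_source.1 hq'))
  have key : ∀ x : B.GaugeSpace × B.GaugeSpace, x ∈ B.gaugeGroupoidOver.composable →
      B.arrow (σ x.1) = x.1 → B.arrow (τ x.2) = x.2 → B.proj (τ x.2).1 ∈ e.baseSet →
      B.gaugeGroupoidOver.mulExt x =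
        B.arrow ((σ x.1).1, MulOpposite.op ((e (τ x.2).1).2⁻¹ * (e (σ x.1).2).2) • (τ x.2).2) := by
    rintro ⟨k, l⟩ hx hk hl hm
    have hx' : B.gaugeSrc k = B.gaugeTgt l := hx
    set a := (e (τ l).1).2⁻¹ * (e (σ k).2).2 with ha
    have hp : B.proj (σ k).2 = B.proj (τ l).1 := by
      rw [← B.gaugeSrc_arrow, ← B.gaugeTgt_arrow, hk, hl, hx']
    have h1 : (σ k).2 = MulOpposite.op a • (τ l).1 := by
      refine B.eq_of_trivialization (e := e) ?_ (hp ▸ hm) ?_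
      · rw [B.proj_act, hp]
      · rw [he.map_act _ (e.mem_source.2 hm), ha]; group
    have h2 : l = B.arrow ((σ k).2, MulOpposite.op a • (τ l).2) := by
      rw [h1]
      exact hl.symm.trans (B.arrow_act a (τ l)).symm
    have h3 : k = B.arrow ((σ k).1, (σ k).2) := hk.symm
    have h4 : B.gaugeGroupoidOver.mulExt (k, l) = B.gaugeMul k l hx' := dif_pos hx
    rw [h4]
    have h5 : ∀ (k' l' : B.GaugeSpace) (c' : B.gaugeSrc k' = B.gaugeTgt l'), k = k' → l = l' →
        B.gaugeMul k l hx' = B.gaugeMul k' l' c' := by rintro _ _ _ rfl rfl; rfl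
    rw [h5 _ _ rfl h3 h2, B.gaugeMul_arrow]
  refine s7.contMDiffWithinAt.congr_of_eventuallyEq ?_
    (key _ c n1.self_of_nhds n2.self_of_nhds n3.self_of_nhds)
  filter_upwards [nhdsWithin_le_nhds n1, nhdsWithin_le_nhds n2, nhdsWithin_le_nhds n3,
    self_mem_nhdsWithin] with x h1 h2 h3 h4 using key x h4 h1 h2 h3

/-- The gauge groupoid `(P × P) / G ⇉ M`, as a Lie groupoid. -/
def gaugeGroupoid : LieGroupoid (IM.prod (IG.prod IM)) IM B.GaugeSpace M where
  toGroupoidOver := B.gaugeGroupoidOver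
  contMDiff_src := B.contMDiff_gaugeSrc
  contMDiff_tgt := B.contMDiff_gaugeTgt
  submersion_src := B.submersion_gaugeSrc
  submersion_tgt := B.submersion_gaugeTgt
  contMDiff_unit := B.contMDiff_gaugeUnit
  contMDiff_inv := contMDiff_of_comp_arrow
    (B.contMDiff_arrow.comp (contMDiff_snd.prodMk contMDiff_fst))
  contMDiffOn_mul := B.contMDiffOn_gaugeMul

variable {B} in
/-- `K` is the vector-valued one-form on the gauge groupoid which corresponds to the principal
connection `θ`: if `Θ(X) = θ(X)_P` is the vertical projection and `[(X, Y)]` denotes the image of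
`(X, Y) ∈ TP × TP` under the derivative of the quotient map `P × P → (P × P) / G`, then
`K [(X, Y)] = [(Θ(X), Θ(Y))]`. -/
def Connection.Induces [IsManifold IP ∞ P] (θ : B.Connection)
    (K : VectorForm (IM.prod (IG.prod IM)) B.GaugeSpace 1) : Prop :=
  ∀ (p q : P) (X : TangentSpace IP p) (Y : TangentSpace IP q),
    K (B.arrow (p, q)) (fun _ =>
        mfderiv (IP.prod IP) (IM.prod (IG.prod IM)) B.arrow (p, q) (X, Y)) =
      mfderiv (IP.prod IP) (IM.prod (IG.prod IM)) B.arrow (p, q)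
        (B.generator (θ.toFun p X) p, B.generator (θ.toFun q Y) q)

end PrincipalBundle
end Principal
end

noncomputable section

/-! Write `q` for the quotient map `P × P → (P × P) / G`. Near every point it has smooth sections,
so `Tq` is surjective and every tangent vector of the gauge groupoid has the form `[(X, Y)]`. Hence
`K ∘ K = K`, because the vertical projection `Θ` is idempotent (`endo_endo`).

Existence and uniqueness hold for every idempotent `K`. The expression `K([(Id - K)X, (Id - K)Y])`
is linear over functions: the extra term in the Leibniz rule is a multiple of `(Id - K)X` or `(Id -
K)Y`, and `K` kills both (`tensorialAt_curvatureOp_left`). It therefore defines an alternating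
bilinear form on each tangent space, smooth because brackets of smooth fields are smooth. The
defining identity determines the form, since on a Hausdorff manifold every tangent vector is the
value of a global smooth field (`IsCurvature.unique`).

Multiplicativity holds with the zero form on the base. Suppose that `R` sends `[(X₀, Y₀)], [(X₁,
Y₁)]` to `[(ρ(X₀, X₁), ρ(Y₀, Y₁))]`, where `ρ` has vertical values. Source and target then
annihilate the values of `R`. Two composable tangent vectors can be written `[(X, Y)]`, `[(Y, Z)]`
with the same `Y`, and their product is `[(X, Z)]`; so `R` respects products by inspection
(`isMultiplicative_of_factors`).

It remains to see that the curvature of `K` has this shape, where `ρ` is the curvature of `θ`, the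
vertical part of the bracket of horizontal lifts (`curvature_arrow`). The curvature of `K` depends
only on the `(Id - K)`-parts of its arguments, so the arguments may be replaced by values of
convenient fields: fields on `M` are lifted to invariant fields on `P` in principal trivializations,
and pairs of these descend to the gauge groupoid (`gaugeField`). Applying `Id - K` to such a field
gives a field `q`-related to the pair of horizontal lifts. Brackets of related fields are related
(`mfderiv_mlieBracket_of_related`); used for `q` and for both projections of `P × P`, this computes
the bracket componentwise, and `K` then applies `Θ` to each component. -/

theorem two_le_infty : (2 : WithTop ℕ∞) ≤ ∞ := by
  exact WithTop.coe_le_coe.2 (le_top : (2 : ℕ∞) ≤ ⊤)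

/-! ### Lie brackets as commutators of derivations, and brackets of related fields -/

section RelatedFields

variable {E H E' H' F : Type*} [NormedAddCommGroup E] [NormedSpace ℝ E]
  [TopologicalSpace H] [NormedAddCommGroup E'] [NormedSpace ℝ E'] [TopologicalSpace H']
  [NormedAddCommGroup F] [NormedSpace ℝ F]
  {I : ModelWithCorners ℝ E H} [I.Boundaryless] {I' : ModelWithCorners ℝ E' H'} [I'.Boundaryless]
  {N N' : Type*} [TopologicalSpace N] [ChartedSpace H N] [IsManifold I ∞ N]
  [TopologicalSpace N'] [ChartedSpace H' N'] [IsManifold I' ∞ N']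

/-- The pullback of `W` applies the inverse of the derivative of the inverse chart, which cancels in
the chain rule. Derivatives along fields on the manifold thus become derivatives along their
coordinate expressions. Without boundary the range of `I` is the whole space, so derivatives within
the range are plain derivatives. -/
theorem fderiv_comp_extChartAt_symm_mpullback {x : N} {z : E} (hz : z ∈ (extChartAt I x).target)
    {u : N → F} (hu : MDifferentiableAt I 𝓘(ℝ, F) u ((extChartAt I x).symm z))
    (W : ∀ y : N, TangentSpace I y) :
    fderiv ℝ (u ∘ (extChartAt I x).symm) z
        (VectorField.mpullback 𝓘(ℝ, E) I (extChartAt I x).symm W z) =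
      (mfderiv I 𝓘(ℝ, F) u ((extChartAt I x).symm z) (W ((extChartAt I x).symm z)) : F) := by
  have : IsManifold I 1 N := IsManifold.of_le (n := ∞) (by simp)
  have h0 := isInvertible_mfderivWithin_extChartAt_symm (I := I) hz
  have h1 : MDifferentiableAt 𝓘(ℝ, E) I (extChartAt I x).symm z := by
    have := mdifferentiableWithinAt_extChartAt_symm (I := I) hz
    rwa [I.range_eq_univ, mdifferentiableWithinAt_univ] at this
  rw [I.range_eq_univ, mfderivWithin_univ] at h0
  have h2 : mfderiv 𝓘(ℝ, E) 𝓘(ℝ, F) (u ∘ (extChartAt I x).symm) z = _ := mfderiv_comp z hu h1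
  have h3 := DFunLike.congr_fun h2 (VectorField.mpullback 𝓘(ℝ, E) I (extChartAt I x).symm W z)
  rw [mfderiv_eq_fderiv] at h3
  exact h3.trans (congrArg (mfderiv I 𝓘(ℝ, F) u ((extChartAt I x).symm z))
    (h0.self_apply_inverse _))

theorem contMDiffAt_extChartAt_symm (x : N) :
    ContMDiffAt 𝓘(ℝ, E) I ∞ (extChartAt I x).symm (extChartAt I x x) := by
  have := contMDiffWithinAt_extChartAt_symm_range (I := I) (n := ∞) x (mem_extChartAt_target x)
  rwa [I.range_eq_univ, contMDiffWithinAt_univ] at this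

variable [CompleteSpace E]

theorem differentiableAt_mpullback_extChartAt_symm {x : N} {V : ∀ y : N, TangentSpace I y}
    (hV : MDifferentiableAt I I.tangent (fun y => (⟨y, V y⟩ : TangentBundle I N)) x) :
    DifferentiableAt ℝ (VectorField.mpullback 𝓘(ℝ, E) I (extChartAt I x).symm V)
      (extChartAt I x x) := by
  have : IsManifold I 2 N := IsManifold.of_le two_le_infty
  have hV1 := hV.mdifferentiableWithinAt (s := univ)
    |>.differentiableWithinAt_mpullbackWithin_vectorField
  simp only [I.range_eq_univ, preimage_univ, inter_univ, VectorField.mpullbackWithin_univ] at hV1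
  exact differentiableWithinAt_univ.1 hV1

/-- The Lie bracket acts on functions as a commutator of derivations. -/
theorem mfderiv_mlieBracket {x : N} {u : N → F} (hu : ContMDiffAt I 𝓘(ℝ, F) ∞ u x)
    {V W : ∀ y : N, TangentSpace I y}
    (hV : MDifferentiableAt I I.tangent (fun y => (⟨y, V y⟩ : TangentBundle I N)) x)
    (hW : MDifferentiableAt I I.tangent (fun y => (⟨y, W y⟩ : TangentBundle I N)) x)
    {v w : N → F} (hv : MDifferentiableAt I 𝓘(ℝ, F) v x) (hw : MDifferentiableAt I 𝓘(ℝ, F) w x)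
    (hv' : ∀ᶠ y in 𝓝 x, v y = mfderiv I 𝓘(ℝ, F) u y (V y))
    (hw' : ∀ᶠ y in 𝓝 x, w y = mfderiv I 𝓘(ℝ, F) u y (W y)) :
    mfderiv I 𝓘(ℝ, F) u x (VectorField.mlieBracket I V W x) =
      (id (mfderiv I 𝓘(ℝ, F) w x (V x)) : F) - (id (mfderiv I 𝓘(ℝ, F) v x (W x)) : F) := by
  have : IsManifold I 1 N := IsManifold.of_le (n := ∞) (by simp)
  set φ := extChartAt I x with hφ
  set z₀ := φ x with hz₀
  have hz : z₀ ∈ φ.target := mem_extChartAt_target x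
  have hx : φ.symm z₀ = x := extChartAt_to_inv x
  have hV1 := differentiableAt_mpullback_extChartAt_symm hV
  have hW1 := differentiableAt_mpullback_extChartAt_symm hW
  have hsymm : ContMDiffAt 𝓘(ℝ, E) I ∞ φ.symm z₀ := contMDiffAt_extChartAt_symm x
  have hcont : Filter.Tendsto φ.symm (𝓝 z₀) (𝓝 x) := by
    have := hsymm.continuousAt
    rwa [ContinuousAt, hx] at this
  have hu1 : ContDiffAt ℝ ∞ (u ∘ φ.symm) z₀ :=
    (ContMDiffAt.comp z₀ (hx.symm ▸ hu) hsymm).contDiffAt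
  have hu2 : ∀ᶠ y in 𝓝 x, MDifferentiableAt I 𝓘(ℝ, F) u y := by
    filter_upwards [(contMDiffAt_iff_contMDiffAt_nhds (n := 1) (by simp)).1
      (ContMDiffAt.of_le hu (by simp))] with y hy
    exact hy.mdifferentiableAt (by simp)
  have htgt : ∀ᶠ z in 𝓝 z₀, z ∈ φ.target := (isOpen_extChartAt_target x).mem_nhds hz
  have key : ∀ (W : ∀ y : N, TangentSpace I y) (w : N → F),
      (∀ᶠ y in 𝓝 x, w y = mfderiv I 𝓘(ℝ, F) u y (W y)) →
      (fun z => fderiv ℝ (u ∘ φ.symm) z (VectorField.mpullback 𝓘(ℝ, E) I φ.symm W z)) =ᶠ[𝓝 z₀]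
        w ∘ φ.symm := by
    intro W w hw
    filter_upwards [htgt, hcont.eventually hu2, hcont.eventually hw] with z h1 h2 h3
    exact (fderiv_comp_extChartAt_symm_mpullback h1 h2 W).trans h3.symm
  have hpt : ∀ (W : ∀ y : N, TangentSpace I y) (w : N → F), MDifferentiableAt I 𝓘(ℝ, F) w x →
      fderiv ℝ (w ∘ φ.symm) z₀ (VectorField.mpullback 𝓘(ℝ, E) I φ.symm W z₀) =
        (mfderiv I 𝓘(ℝ, F) w x (W x) : F) := by
    intro W w hw
    have h1 := fderiv_comp_extChartAt_symm_mpullback (I := I) hz (u := w) (by rw [hx]; exact hw) W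
    rw [h1]
    exact congrArg (fun y => (mfderiv I 𝓘(ℝ, F) w y (W y) : F)) hx
  -- In coordinates the claim comes from the symmetry of the second derivative of `u ∘ φ.symm`;
  -- `key` and `hpt` translate the terms back to the manifold.
  have hb := VectorField.fderiv_apply_lieBracket hu1 (by simpa using two_le_infty) hW1 hV1
  rw [(key V v hv').fderiv_eq, (key W w hw').fderiv_eq, hpt W v hv, hpt V w hw] at hb
  refine Eq.trans ?_ hb
  -- The bracket at `x` is the image of the coordinate bracket under the inverse of the derivative
  -- of `φ`. This inverse cancels once the derivative of `u` is factored through that of `φ`.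
  rw [← VectorField.mlieBracketWithin_univ, VectorField.mlieBracketWithin_apply]
  simp only [I.range_eq_univ, preimage_univ, inter_univ, VectorField.mpullbackWithin_univ]
  have hi := isInvertible_mfderiv_extChartAt (I := I) (mem_extChartAt_source (I := I) x)
  have huc : HasMFDerivAt I 𝓘(ℝ, F) ((u ∘ φ.symm) ∘ φ) x _ :=
    HasMFDerivAt.comp x (hu1.differentiableAt (by simp)).hasFDerivAt.hasMFDerivAt
      (mdifferentiableAt_extChartAt (mem_chart_source H x)).hasMFDerivAt
  have hue : (u ∘ φ.symm) ∘ φ =ᶠ[𝓝 x] u :=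
    Filter.eventuallyEq_of_mem (extChartAt_source_mem_nhds (I := I) x) fun y hy =>
      congrArg u (φ.left_inv hy)
  rw [hasMFDerivAt_unique hu2.self_of_nhds.hasMFDerivAt (huc.congr_of_eventuallyEq hue.symm)]
  refine congrArg (fderiv ℝ (u ∘ φ.symm) z₀) ((hi.self_apply_inverse _).trans ?_)
  exact congrFun VectorField.lieBracketWithin_univ z₀

/-- This supplies the functions `v` and `w` to which the commutator formula is applied when `u` is a
chart. Differentiability of `V` at the single point `x` is enough, because in coordinates the
function is the derivative of a smooth map applied to a field differentiable there. -/
theorem mdifferentiableAt_mfderiv_apply {x : N} {u : N → F} (hu : ContMDiffAt I 𝓘(ℝ, F) ∞ u x)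
    {V : ∀ y : N, TangentSpace I y}
    (hV : MDifferentiableAt I I.tangent (fun y => (⟨y, V y⟩ : TangentBundle I N)) x) :
    MDifferentiableAt I 𝓘(ℝ, F) (M' := F) (fun y => mfderiv I 𝓘(ℝ, F) u y (V y)) x := by
  have hx := extChartAt_to_inv (I := I) x
  have hu1 : ContDiffAt ℝ ∞ (u ∘ (extChartAt I x).symm) (extChartAt I x x) :=
    (ContMDiffAt.comp _ (hx.symm ▸ hu) (contMDiffAt_extChartAt_symm x)).contDiffAt
  have h1 : DifferentiableAt ℝ (fun z => fderiv ℝ (u ∘ (extChartAt I x).symm) z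
      (VectorField.mpullback 𝓘(ℝ, E) I (extChartAt I x).symm V z)) (extChartAt I x x) :=
    ((hu1.fderiv_right (m := 1) two_le_infty).differentiableAt (by simp)).clm_apply
      (differentiableAt_mpullback_extChartAt_symm hV)
  refine (h1.mdifferentiableAt.comp x
    (mdifferentiableAt_extChartAt (mem_chart_source H x))).congr_of_eventuallyEq ?_
  filter_upwards [extChartAt_source_mem_nhds (I := I) x,
    (contMDiffAt_iff_contMDiffAt_nhds (n := 1) (by simp)).1 (ContMDiffAt.of_le hu (by simp))]
    with y h2 h3
  have h4 := (extChartAt I x).left_inv h2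
  refine Eq.symm ((fderiv_comp_extChartAt_symm_mpullback ((extChartAt I x).map_source h2)
    (by rw [h4]; exact h3.mdifferentiableAt (by simp)) V).trans ?_)
  exact congrArg (fun y => (mfderiv I 𝓘(ℝ, F) u y (V y) : F)) h4

variable [CompleteSpace E']

/-- The Lie bracket is natural for related vector fields. -/
theorem mfderiv_mlieBracket_of_related {x : N'} {f : N' → N} (hf : ContMDiffAt I' I ∞ f x)
    {V W : ∀ y : N', TangentSpace I' y} {V' W' : ∀ y : N, TangentSpace I y}
    (hV : MDifferentiableAt I' I'.tangent (fun y => (⟨y, V y⟩ : TangentBundle I' N')) x)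
    (hW : MDifferentiableAt I' I'.tangent (fun y => (⟨y, W y⟩ : TangentBundle I' N')) x)
    (hV' : MDifferentiableAt I I.tangent (fun y => (⟨y, V' y⟩ : TangentBundle I N)) (f x))
    (hW' : MDifferentiableAt I I.tangent (fun y => (⟨y, W' y⟩ : TangentBundle I N)) (f x))
    (hVV' : ∀ᶠ y in 𝓝 x, mfderiv I' I f y (V y) = V' (f y))
    (hWW' : ∀ᶠ y in 𝓝 x, mfderiv I' I f y (W y) = W' (f y)) :
    mfderiv I' I f x (VectorField.mlieBracket I' V W x) =
      VectorField.mlieBracket I V' W' (f x) := by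
  have : IsManifold I 1 N := IsManifold.of_le (n := ∞) (by simp)
  -- The chart at `f x` serves as a vector-valued test function: its derivative there is injective,
  -- so the two brackets can be compared after applying it.
  set u := extChartAt I (f x) with hu
  have hu1 : ContMDiffAt I 𝓘(ℝ, E) ∞ u (f x) := contMDiffAt_extChartAt
  have huf : ContMDiffAt I' 𝓘(ℝ, E) ∞ (u ∘ f) x := hu1.comp x hf
  have hf1 : MDifferentiableAt I' I f x := hf.mdifferentiableAt (by simp)
  have ev : ∀ᶠ y in 𝓝 x, MDifferentiableAt I' I f y := by
    filter_upwards [(contMDiffAt_iff_contMDiffAt_nhds (n := 1) (by simp)).1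
      (ContMDiffAt.of_le hf (by simp))] with y hy
    exact hy.mdifferentiableAt (by simp)
  have ev2 : ∀ᶠ y in 𝓝 x, MDifferentiableAt I 𝓘(ℝ, E) u (f y) := by
    filter_upwards [hf.continuousAt.eventually
      ((contMDiffAt_iff_contMDiffAt_nhds (n := 1) (by simp)).1
        (ContMDiffAt.of_le hu1 (by simp)))] with y hy
    exact hy.mdifferentiableAt (by simp)
  have rel : ∀ (V : ∀ y : N', TangentSpace I' y) (V' : ∀ y : N, TangentSpace I y),
      (∀ᶠ y in 𝓝 x, mfderiv I' I f y (V y) = V' (f y)) →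
      ∀ᶠ y in 𝓝 x, ((fun y => mfderiv I 𝓘(ℝ, E) u y (V' y) : N → E) ∘ f) y =
        mfderiv I' 𝓘(ℝ, E) (u ∘ f) y (V y) := by
    intro V V' h
    filter_upwards [ev, ev2, h] with y h1 h2 h3
    rw [mfderiv_comp y h2 h1]
    exact congrArg (mfderiv I 𝓘(ℝ, E) u (f y)) h3.symm
  have dV := mdifferentiableAt_mfderiv_apply hu1 hV'
  have dW := mdifferentiableAt_mfderiv_apply hu1 hW'
  -- By relatedness, the derivative of `u ∘ f` along `V` is the derivative of `u` along `V'`,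
  -- composed with `f`. The two commutators `e1` and `e2` therefore agree by the chain rule.
  have e1 := mfderiv_mlieBracket huf hV hW (dV.comp x hf1) (dW.comp x hf1)
    (rel V V' hVV') (rel W W' hWW')
  have e2 := mfderiv_mlieBracket hu1 hV' hW' dV dW (.of_forall fun _ => rfl)
    (.of_forall fun _ => rfl)
  rw [mfderiv_comp x ev2.self_of_nhds hf1, mfderiv_comp x dV hf1, mfderiv_comp x dW hf1] at e1
  have hi := isInvertible_mfderiv_extChartAt (I := I) (mem_extChartAt_source (I := I) (f x))
  refine hi.injective (e1.trans (Eq.trans ?_ e2.symm))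
  rw [← hVV'.self_of_nhds, ← hWW'.self_of_nhds]
  rfl

end RelatedFields

/-! ### The curvature of an idempotent vector-valued one-form -/

section Curvature

variable {E H : Type*} [NormedAddCommGroup E] [NormedSpace ℝ E]
  [TopologicalSpace H] {I : ModelWithCorners ℝ E H} {N : Type*} [TopologicalSpace N]
  [ChartedSpace H N] [IsManifold I ∞ N]

namespace VectorForm

theorem ext {k : ℕ} {R R' : VectorForm I N k}
    (h : ∀ (x : N) (v : Fin k → TangentSpace I x), R x v = R' x v) : R = R' := by
  cases R; cases R'
  congr 1
  funext x
  exact ContinuousAlternatingMap.ext (h x)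

/-- The zero form. -/
def zero (k : ℕ) : VectorForm I N k where
  toFun _ := 0
  smooth' _ _ _ _ :=
    (contMDiff_zeroSection ℝ (TangentSpace I : N → Type _)).contMDiffOn

/-- The endomorphism of the tangent space at `x` given by a vector-valued one-form. -/
def endo (K : VectorForm I N 1) (x : N) : TangentSpace I x →L[ℝ] TangentSpace I x :=
  (ContinuousAlternatingMap.ofSubsingleton ℝ _ _ (0 : Fin 1)).symm (K x)

/-- The endomorphism `Id - K` of the tangent space at `x`. -/
def compl (K : VectorForm I N 1) (x : N) : TangentSpace I x →L[ℝ] TangentSpace I x :=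
  .id ℝ _ - K.endo x

theorem compl_apply (K : VectorForm I N 1) (x : N) (v : TangentSpace I x) :
    K.compl x v = v - K.endo x v := rfl

theorem smoothFieldOn_endo (K : VectorForm I N 1) {U : Set N} (hU : IsOpen U)
    {X : ∀ x : N, TangentSpace I x} (hX : SmoothFieldOn I N X U) :
    SmoothFieldOn I N (fun x => K.endo x (X x)) U :=
  K.smooth' U hU (fun _ => X) fun _ => hX

theorem smoothFieldOn_compl (K : VectorForm I N 1) {U : Set N} (hU : IsOpen U)
    {X : ∀ x : N, TangentSpace I x} (hX : SmoothFieldOn I N X U) :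
    SmoothFieldOn I N (fun x => K.compl x (X x)) U :=
  ContMDiffOn.sub_section hX (K.smoothFieldOn_endo hU hX)

/-- The curvature of `K`, as an operation on vector fields. -/
def curvatureOp (K : VectorForm I N 1) (x : N) (X Y : ∀ x : N, TangentSpace I x) :
    TangentSpace I x :=
  K.endo x (VectorField.mlieBracket I (fun y => K.compl y (X y)) (fun y => K.compl y (Y y)) x)

theorem curvatureOp_swap (K : VectorForm I N 1) (x : N) (X Y : ∀ x : N, TangentSpace I x) :
    K.curvatureOp x X Y = - K.curvatureOp x Y X := by
  rw [curvatureOp, VectorField.mlieBracket_swap_apply, map_neg]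
  rfl

variable [FiniteDimensional ℝ E]

/-- Smoothness of `K` is stated for smooth fields on open sets, whereas tensoriality is tested on
fields that are only differentiable at `x`. Expanding in a smooth local frame bridges the two: `K`
of the frame fields is smooth, and the coefficients are differentiable at `x`. -/
theorem mdifferentiableAt_endo (K : VectorForm I N 1) {x : N}
    {X : ∀ x : N, TangentSpace I x}
    (hX : MDifferentiableAt I I.tangent (fun y => (⟨y, X y⟩ : TangentBundle I N)) x) :
    MDifferentiableAt I I.tangent
      (fun y => (⟨y, K.endo y (X y)⟩ : TangentBundle I N)) x := by
  have : IsManifold I 1 N := IsManifold.of_le (n := ∞) (by simp)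
  let t := trivializationAt E (TangentSpace I : N → Type _) x
  have hx : x ∈ t.baseSet := FiberBundle.mem_baseSet_trivializationAt E (TangentSpace I) x
  let b := Module.Basis.ofVectorSpace ℝ E
  have hs (i) : SmoothFieldOn I N (t.localFrame b i) t.baseSet :=
    t.contMDiffOn_localFrame_baseSet ∞ b i
  have hK (i) := ((K.smoothFieldOn_endo t.open_baseSet (hs i)).contMDiffAt
    (t.open_baseSet.mem_nhds hx)).mdifferentiableAt (by simp)
  have hc (i) := mdifferentiableAt_localFrameCoeff (I := I) b hx hX i
  have h1 := MDifferentiableAt.sum_section (s := Finset.univ)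
    fun i _ => (hc i).smul_section (hK i)
  refine h1.congr_of_eventuallyEq ?_
  filter_upwards [t.eventually_eq_localFrame_sum_coeff_smul (I := I) b hx] with y hy
  have h2 : K.endo y (X y) = K.endo y (∑ i, t.localFrameCoeff I b i y (X y) • t.localFrame b i y) :=
    congrArg _ hy
  rw [h2, map_sum]
  simp

theorem mdifferentiableAt_compl (K : VectorForm I N 1) {x : N} {X : ∀ x : N, TangentSpace I x}
    (hX : MDifferentiableAt I I.tangent (fun y => (⟨y, X y⟩ : TangentBundle I N)) x) :
    MDifferentiableAt I I.tangent
      (fun y => (⟨y, K.compl y (X y)⟩ : TangentBundle I N)) x :=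
  mdifferentiableAt_sub_section hX (K.mdifferentiableAt_endo hX)

/-- In `[f (Id - K)X, (Id - K)Y]` the term with the derivative of `f` is a multiple of `(Id - K)X`.
Idempotence gives `K ∘ (Id - K) = 0`, so `K` removes it. -/
theorem tensorialAt_curvatureOp_left {K : VectorForm I N 1}
    (hK : ∀ x v, K.endo x (K.endo x v) = K.endo x v) (x : N) (Y : ∀ x : N, TangentSpace I x) :
    TensorialAt I E (fun X => K.curvatureOp x X Y) x := by
  have : IsManifold I 2 N := IsManifold.of_le two_le_infty
  have : IsManifold I 1 N := IsManifold.of_le (n := ∞) (by simp)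
  have hKc (v : TangentSpace I x) : K.endo x (K.compl x v) = 0 := by
    rw [compl_apply, map_sub, hK, sub_self]
  constructor
  · intro f X hf hX
    have h1 : (fun y => K.compl y ((f • X) y)) = f • fun y => K.compl y (X y) := by
      funext y
      exact map_smul (K.compl y) (f y) (X y)
    rw [curvatureOp, h1, VectorField.mlieBracket_smul_left hf (K.mdifferentiableAt_compl hX),
      map_add, map_smul, map_smul, hKc, smul_zero, zero_add]
    rfl
  · intro X X' hX hX'
    have h1 : (fun y => K.compl y ((X + X') y)) =
        (fun y => K.compl y (X y)) + fun y => K.compl y (X' y) := by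
      funext y
      exact map_add (K.compl y) (X y) (X' y)
    rw [curvatureOp, h1, VectorField.mlieBracket_add_left (K.mdifferentiableAt_compl hX)
      (K.mdifferentiableAt_compl hX'), map_add]
    rfl

theorem tensorialAt_curvatureOp_right {K : VectorForm I N 1}
    (hK : ∀ x v, K.endo x (K.endo x v) = K.endo x v) (x : N) (X : ∀ x : N, TangentSpace I x) :
    TensorialAt I E (K.curvatureOp x X) x := by
  have h := tensorialAt_curvatureOp_left hK x X
  constructor
  · intro f Y hf hY
    rw [curvatureOp_swap, h.smul hf hY, ← smul_neg, ← curvatureOp_swap]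
  · intro Y Y' hY hY'
    rw [curvatureOp_swap, h.add hY hY', neg_add, ← curvatureOp_swap, ← curvatureOp_swap]

/-- The curvature of `K` at `x`, as a bilinear map. -/
def curvatureBilin {K : VectorForm I N 1} (hK : ∀ x v, K.endo x (K.endo x v) = K.endo x v)
    (x : N) : TangentSpace I x →L[ℝ] TangentSpace I x →L[ℝ] TangentSpace I x :=
  have : IsManifold I 1 N := IsManifold.of_le (n := ∞) (by simp)
  TensorialAt.mkHom₂ (I := I) (F := E) (F' := E) (K.curvatureOp x) x
    (fun Y _ => tensorialAt_curvatureOp_left hK x Y)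
    (fun X _ => tensorialAt_curvatureOp_right hK x X)

/-- By tensoriality any extensions of the two vectors may be used, provided that they are
differentiable at `x`. This freedom is what allows the curvature to be computed with adapted fields.
-/
theorem curvatureBilin_apply {K : VectorForm I N 1}
    (hK : ∀ x v, K.endo x (K.endo x v) = K.endo x v) {x : N} {X Y : ∀ x : N, TangentSpace I x}
    (hX : MDifferentiableAt I I.tangent (fun y => (⟨y, X y⟩ : TangentBundle I N)) x)
    (hY : MDifferentiableAt I I.tangent (fun y => (⟨y, Y y⟩ : TangentBundle I N)) x) :
    curvatureBilin hK x (X x) (Y x) = K.curvatureOp x X Y := by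
  have : IsManifold I 1 N := IsManifold.of_le (n := ∞) (by simp)
  exact TensorialAt.mkHom₂_apply (I := I) (F := E) (F' := E)
    (fun Y _ => tensorialAt_curvatureOp_left hK x Y)
    (fun X _ => tensorialAt_curvatureOp_right hK x X) hX hY

theorem curvatureBilin_self {K : VectorForm I N 1}
    (hK : ∀ x v, K.endo x (K.endo x v) = K.endo x v) (x : N) (v : TangentSpace I x) :
    curvatureBilin hK x v v = 0 := by
  have : IsManifold I 1 N := IsManifold.of_le (n := ∞) (by simp)
  have h := curvatureBilin_apply hK (FiberBundle.mdifferentiableAt_extend I E v)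
    (FiberBundle.mdifferentiableAt_extend I E v)
  rw [FiberBundle.extend_apply_self] at h
  rw [h, curvatureOp, VectorField.mlieBracket_self]
  exact map_zero _

/-- The curvature of a projection `K`, as a vector-valued two-form. -/
def curvature {K : VectorForm I N 1} (hK : ∀ x v, K.endo x (K.endo x v) = K.endo x v) :
    VectorForm I N 2 where
  toFun x :=
    { toFun := fun v => curvatureBilin hK x (v 0) (v 1)
      map_update_add' := by
        intro _ _ i _ _
        fin_cases i <;> simp
      map_update_smul' := by
        intro _ _ i _ _
        fin_cases i <;> simp
      cont := by fun_prop
      map_eq_zero_of_eq' := by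
        intro v i j hij hne
        have h : v 0 = v 1 := by
          fin_cases i <;> fin_cases j <;> first | exact absurd rfl hne | exact hij | exact hij.symm
        change curvatureBilin hK x (v 0) (v 1) = 0
        rw [h, curvatureBilin_self] }
  smooth' := by
    intro U hU X hX
    have : IsManifold I (minSmoothness ℝ 2) N := by
      rw [minSmoothness_of_isRCLikeNormedField]
      exact IsManifold.of_le two_le_infty
    -- Bracketing costs one derivative, and `∞ + 1` is `∞`.
    have : IsManifold I (((⊤ : ℕ∞) : WithTop ℕ∞) + 1) N := inferInstanceAs (IsManifold I ∞ N)
    have h1 : SmoothFieldOn I N (fun x => VectorField.mlieBracket I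
        (fun y => K.compl y (X 0 y)) (fun y => K.compl y (X 1 y)) x) U := fun x hx =>
      (ContMDiffAt.mlieBracket_vectorField (m := ⊤) (n := ⊤)
        ((K.smoothFieldOn_compl hU (hX 0)).contMDiffAt (hU.mem_nhds hx))
        ((K.smoothFieldOn_compl hU (hX 1)).contMDiffAt (hU.mem_nhds hx))
        (by rw [minSmoothness_of_isRCLikeNormedField]; rfl)).contMDiffWithinAt
    refine (K.smoothFieldOn_endo hU h1).congr fun x hx => ?_
    exact congrArg (fun v : TangentSpace I x => (⟨x, v⟩ : TangentBundle I N))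
      (curvatureBilin_apply hK
        (((hX 0).contMDiffAt (hU.mem_nhds hx)).mdifferentiableAt (by simp))
        (((hX 1).contMDiffAt (hU.mem_nhds hx)).mdifferentiableAt (by simp)))

theorem isCurvature_curvature {K : VectorForm I N 1}
    (hK : ∀ x v, K.endo x (K.endo x v) = K.endo x v) : IsCurvature K (curvature hK) := by
  intro X Y hX hY x
  exact curvatureBilin_apply hK
    ((hX.contMDiffAt Filter.univ_mem).mdifferentiableAt (by simp))
    ((hY.contMDiffAt Filter.univ_mem).mdifferentiableAt (by simp))

/-- The vector `K v` extends to `K` applied to an extension of `v`. That field is annihilated by `Id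
- K` everywhere, so the bracket in the curvature is the bracket with the zero field. -/
theorem curvatureBilin_endo_left {K : VectorForm I N 1}
    (hK : ∀ x v, K.endo x (K.endo x v) = K.endo x v) (x : N) (v w : TangentSpace I x) :
    curvatureBilin hK x (K.endo x v) w = 0 := by
  have : IsManifold I 1 N := IsManifold.of_le (n := ∞) (by simp)
  have h := curvatureBilin_apply hK
    (K.mdifferentiableAt_endo (FiberBundle.mdifferentiableAt_extend I E v))
    (FiberBundle.mdifferentiableAt_extend I E w)
  rw [FiberBundle.extend_apply_self, FiberBundle.extend_apply_self] at h
  have h0 : (fun y => K.compl y (K.endo y (FiberBundle.extend E v y))) = 0 := by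
    funext y
    rw [compl_apply, hK, sub_self]
    rfl
  rw [h, curvatureOp, h0, VectorField.mlieBracket_zero_left]
  exact map_zero _

theorem curvatureBilin_endo_right {K : VectorForm I N 1}
    (hK : ∀ x v, K.endo x (K.endo x v) = K.endo x v) (x : N) (v w : TangentSpace I x) :
    curvatureBilin hK x v (K.endo x w) = 0 := by
  -- Expanding the vanishing diagonal value at `v + K w`, every term except `(v, K w)` is already
  -- known to be zero.
  have h := curvatureBilin_self hK x (v + K.endo x w)
  simpa [curvatureBilin_self, curvatureBilin_endo_left] using h

/-- The curvature depends on the images of the vectors under `Id - K` only. -/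
theorem curvatureBilin_congr {K : VectorForm I N 1}
    (hK : ∀ x v, K.endo x (K.endo x v) = K.endo x v) {x : N} {v v' w w' : TangentSpace I x}
    (hv : K.compl x v = K.compl x v') (hw : K.compl x w = K.compl x w') :
    curvatureBilin hK x v w = curvatureBilin hK x v' w' := by
  have key : ∀ v w, curvatureBilin hK x v w =
      curvatureBilin hK x (K.compl x v) (K.compl x w) := by
    intro v w
    simp [compl_apply, curvatureBilin_endo_left, curvatureBilin_endo_right]
  rw [key, key v', hv, hw]

variable [T2Space N]

/-- Every tangent vector is the value of a smooth vector field. -/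
theorem exists_smoothField (x : N) (v : TangentSpace I x) :
    ∃ X : ∀ x : N, TangentSpace I x, SmoothFieldOn I N X univ ∧ X x = v := by
  obtain ⟨s, hs, hs'⟩ := FiberBundle.exists_contMDiffOn_extend (k := ∞) I E v
  -- The bump function is supported where the local extension of `v` is smooth, and it equals `1` at
  -- `x`; the product is then globally smooth with value `v` at `x`.
  obtain ⟨f, -, hf⟩ := (SmoothBumpFunction.nhds_basis_tsupport (I := I) x).mem_iff.1
    (interior_mem_nhds.2 hs)
  refine ⟨fun y => f y • FiberBundle.extend E v y, ?_, ?_⟩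
  · exact (ContMDiffOn.smul_section_of_tsupport f.contMDiff.contMDiffOn isOpen_interior hf
      (hs'.mono interior_subset)).contMDiffOn
  · simp

end VectorForm

/-- The defining identity speaks of global fields only, so uniqueness rests on global smooth fields
passing through every pair of tangent vectors. -/
theorem IsCurvature.unique [FiniteDimensional ℝ E] [T2Space N] {K : VectorForm I N 1}
    {R R' : VectorForm I N 2} (h : IsCurvature K R) (h' : IsCurvature K R') : R = R' := by
  refine VectorForm.ext fun x v => ?_
  obtain ⟨X, hX, hX'⟩ := VectorForm.exists_smoothField x (v 0)
  obtain ⟨Y, hY, hY'⟩ := VectorForm.exists_smoothField x (v 1)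
  have hv : v = ![X x, Y x] := by
    funext i
    fin_cases i
    · exact hX'.symm
    · exact hY'.symm
  rw [hv, h X Y hX hY, h' X Y hX hY]

end Curvature

/-! ### Calculus of derivatives between model spaces -/

section Chain

variable {E E' E'' H H' H'' N N' N'' : Type*}
  [NormedAddCommGroup E] [NormedSpace ℝ E] [TopologicalSpace H] {I : ModelWithCorners ℝ E H}
  [NormedAddCommGroup E'] [NormedSpace ℝ E'] [TopologicalSpace H'] {I' : ModelWithCorners ℝ E' H'}
  [NormedAddCommGroup E''] [NormedSpace ℝ E''] [TopologicalSpace H'']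
  {I'' : ModelWithCorners ℝ E'' H''}
  [TopologicalSpace N] [ChartedSpace H N] [TopologicalSpace N'] [ChartedSpace H' N']
  [TopologicalSpace N''] [ChartedSpace H'' N'']

variable (I I') in
/-- The derivative of a map between manifolds, as a map between the model spaces of the tangent
spaces. -/
def modelDeriv (f : N → N') (x : N) : E →L[ℝ] E' := mfderiv I I' f x

/-- The base point `y` is tied to `f x` only by an equation. The chain rule thus applies where the
points agree by a computation such as `1 • p = p`, without transport between tangent spaces. -/
theorem modelDeriv_comp {f : N → N'} {g : N' → N''} {x : N} {y : N'} (hy : f x = y)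
    (hg : MDifferentiableAt I' I'' g y) (hf : MDifferentiableAt I I' f x) (v : E) :
    modelDeriv I I'' (g ∘ f) x v = modelDeriv I' I'' g y (modelDeriv I I' f x v) := by
  subst hy
  rw [modelDeriv, mfderiv_comp x hg hf]
  rfl

theorem modelDeriv_congr {f g : N → N'} {x : N} (h : f =ᶠ[𝓝 x] g) :
    modelDeriv I I' f x = modelDeriv I I' g x := h.mfderiv_eq

theorem modelDeriv_const (c : N') (x : N) (v : E) : modelDeriv I I' (fun _ : N => c) x v = 0 := by
  rw [modelDeriv, mfderiv_const]; rfl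

theorem modelDeriv_id (x : N) (v : E) : modelDeriv I I id x v = v := by
  rw [modelDeriv, mfderiv_id]; rfl

theorem modelDeriv_fst (z : N × N') (v : E × E') :
    modelDeriv (I.prod I') I Prod.fst z v = v.1 := by
  rw [modelDeriv, mfderiv_fst]; rfl

theorem modelDeriv_snd (z : N × N') (v : E × E') :
    modelDeriv (I.prod I') I' Prod.snd z v = v.2 := by
  rw [modelDeriv, mfderiv_snd]; rfl

theorem modelDeriv_prodMk {f : N → N'} {g : N → N''} {x : N} (hf : MDifferentiableAt I I' f x)
    (hg : MDifferentiableAt I I'' g x) (v : E) :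
    modelDeriv I (I'.prod I'') (fun y => (f y, g y)) x v =
      (modelDeriv I I' f x v, modelDeriv I I'' g x v) := by
  rw [modelDeriv, mfderiv_prodMk hf hg]; rfl

end Chain

/-! ### Vertical vectors on `P` and the derivative of the quotient map -/

section Gauge

variable {EM HM EG HG EP HP : Type*}
  [NormedAddCommGroup EM] [NormedSpace ℝ EM] [TopologicalSpace HM]
  [NormedAddCommGroup EG] [NormedSpace ℝ EG] [TopologicalSpace HG]
  [NormedAddCommGroup EP] [NormedSpace ℝ EP] [TopologicalSpace HP]
  {IM : ModelWithCorners ℝ EM HM} {IG : ModelWithCorners ℝ EG HG} {IP : ModelWithCorners ℝ EP HP}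
  {M G P : Type*}
  [TopologicalSpace M] [ChartedSpace HM M] [TopologicalSpace P] [ChartedSpace HP P]
  [TopologicalSpace G] [ChartedSpace HG G] [Group G] [MulAction Gᵐᵒᵖ P]

namespace PrincipalBundle

theorem contMDiff_act_const (B : PrincipalBundle IM IG IP M G P)
    (g : G) : ContMDiff IP IP ∞ fun p : P => MulOpposite.op g • p :=
  B.contMDiff_act.comp (contMDiff_id.prodMk contMDiff_const)

theorem contMDiff_orbit (B : PrincipalBundle IM IG IP M G P) (p : P) :
    ContMDiff IG IP ∞ fun g : G => MulOpposite.op g • p :=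
  B.contMDiff_act.comp (contMDiff_const.prodMk contMDiff_id)

/-- The infinitesimal action `u ↦ u_P(p)`, as a linear map between the model spaces. -/
def generatorMap (_B : PrincipalBundle IM IG IP M G P) (p : P) : EG →L[ℝ] EP :=
  modelDeriv IG IP (fun g : G => MulOpposite.op g • p) 1

variable (B : PrincipalBundle IM IG IP M G P)

theorem modelDeriv_proj_generator (p : P) (u : EG) :
    modelDeriv IP IM B.proj p (B.generatorMap p u) = 0 := by
  rw [generatorMap, ← modelDeriv_comp (f := fun g : G => MulOpposite.op g • p) (x := 1)
    (one_smul _ p)    ((B.contMDiff_proj p).mdifferentiableAt (by simp))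
    ((B.contMDiff_orbit p 1).mdifferentiableAt (by simp))]
  have h2 : B.proj ∘ (fun g : G => MulOpposite.op g • p) = fun _ => B.proj p :=
    funext fun g => B.proj_act p g
  rw [h2, modelDeriv_const]

variable {B} in
theorem _root_.IsPrincipalTrivialization.mdifferentiableAt {e : Trivialization G B.proj}
    (he : IsPrincipalTrivialization IM IG IP e) {p : P} (hp : p ∈ e.source) :
    MDifferentiableAt IP (IM.prod IG) e p :=
  ((he.contMDiffOn p hp).contMDiffAt (e.open_source.mem_nhds hp)).mdifferentiableAt (by simp)

variable {B} in
theorem _root_.IsPrincipalTrivialization.mdifferentiableAt_symm {e : Trivialization G B.proj}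
    (he : IsPrincipalTrivialization IM IG IP e) {y : M × G} (hy : y ∈ e.target) :
    MDifferentiableAt (IM.prod IG) IP e.toOpenPartialHomeomorph.symm y :=
  ((he.contMDiffOn_symm y hy).contMDiffAt (e.open_target.mem_nhds hy)).mdifferentiableAt (by simp)

/-- The vectors tangent to the fibres are the values of infinitesimal generators. -/
theorem exists_generator_eq [LieGroup IG ∞ G] {p : P} {X : EP}
    (hX : modelDeriv IP IM B.proj p X = 0) : ∃ u : EG, B.generatorMap p u = X := by
  obtain ⟨e, hx, he⟩ := B.exists_trivialization (B.proj p)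
  have hp : p ∈ e.source := e.mem_source.2 hx
  have d1 := he.mdifferentiableAt hp
  have d2 := he.mdifferentiableAt_symm (e.map_source hp)
  have k1 : e.toOpenPartialHomeomorph.symm ∘ e =ᶠ[𝓝 p] id :=
    Filter.eventuallyEq_of_mem (e.open_source.mem_nhds hp) fun q hq =>
      e.toOpenPartialHomeomorph.left_inv hq
  have k2 : Prod.fst ∘ e =ᶠ[𝓝 p] B.proj :=
    Filter.eventuallyEq_of_mem (e.open_source.mem_nhds hp) fun q hq => e.coe_fst hq
  set Z : EM × EG := modelDeriv IP (IM.prod IG) e p X with hZ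
  have h1 : X = modelDeriv (IM.prod IG) IP e.toOpenPartialHomeomorph.symm (e p) Z := by
    rw [hZ, ← modelDeriv_comp (f := e) rfl d2 d1, modelDeriv_congr k1, modelDeriv_id]
  have h3 : Z.1 = 0 := by
    rw [hZ, ← modelDeriv_fst (I := IM) (I' := IG) (e p),
      ← modelDeriv_comp (f := e) rfl mdifferentiableAt_fst d1, modelDeriv_congr k2, hX]
  set γ := (e p).2 with hγ
  have d3 : MDifferentiableAt IG IG (fun g : G => γ * g) 1 :=
    (contMDiff_mul_left (I := IG) (n := ∞) (a := γ) 1).mdifferentiableAt (by simp)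
  have d4 : MDifferentiableAt IG IG (fun g : G => γ⁻¹ * g) γ :=
    (contMDiff_mul_left (I := IG) (n := ∞) (a := γ⁻¹) γ).mdifferentiableAt (by simp)
  -- In the trivialization a vertical vector is `(0, Z.2)` with `Z.2` tangent to `G` at `γ`. Left
  -- translation by `γ⁻¹` carries it to the identity, which gives the Lie algebra element.
  set u : EG := modelDeriv IG IG (fun g : G => γ⁻¹ * g) γ Z.2 with hu
  have h6 : modelDeriv IG IG (fun g : G => γ * g) 1 u = Z.2 := by
    rw [hu, ← modelDeriv_comp (inv_mul_cancel γ) d3 d4]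
    have h8 : (fun g : G => γ * g) ∘ (fun g : G => γ⁻¹ * g) = id := funext fun g => by simp
    rw [h8, modelDeriv_id]
  -- In the trivialization the orbit map of `p` is `g ↦ (π(p), γ g)`, so its derivative at `1`
  -- undoes the translation that defines `u`.
  have h9 : (fun g : G => MulOpposite.op g • p) =
      (e.toOpenPartialHomeomorph.symm ∘ (fun h : G => (B.proj p, h))) ∘ fun g : G => γ * g := by
    funext g
    have h10 : MulOpposite.op g • p ∈ e.source := e.mem_source.2 (by rwa [B.proj_act])
    refine (e.toOpenPartialHomeomorph.left_inv h10).symm.trans ?_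
    refine congrArg e.toOpenPartialHomeomorph.symm (Prod.ext ?_ (he.map_act p hp g))
    exact (e.coe_fst h10).trans (B.proj_act p g)
  have hep : e p = (B.proj p, γ) := Prod.ext (e.coe_fst hp) rfl
  have d5 : MDifferentiableAt IG (IM.prod IG) (fun h : G => (B.proj p, h)) γ :=
    mdifferentiableAt_const.prodMk mdifferentiableAt_id
  refine ⟨u, ?_⟩
  rw [generatorMap, h9, modelDeriv_comp (mul_one γ) (MDifferentiableAt.comp γ (hep ▸ d2) d5) d3,
    h6, modelDeriv_comp hep.symm d2 d5,
    modelDeriv_prodMk (g := fun h => h) mdifferentiableAt_const mdifferentiableAt_id,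
    modelDeriv_const, h1]
  refine congrArg (modelDeriv (IM.prod IG) IP e.toOpenPartialHomeomorph.symm (e p)) ?_
  exact Prod.ext h3.symm (modelDeriv_id γ Z.2)

variable [LieGroup IG ∞ G] [IsManifold IM ∞ M]

/-- Arrows with different targets or sources are separated by pulling back open sets of `M`.
Otherwise both lie in the domain of one `gaugeTriv` and are separated in `M × G × M`. The Hausdorff
property is needed for the uniqueness of the curvature. -/
instance [T2Space M] [T2Space G] : T2Space B.GaugeSpace := by
  refine ⟨fun c d hcd => ?_⟩
  by_cases h1 : B.gaugeTgt c = B.gaugeTgt d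
  swap; · exact separated_by_continuous B.continuous_gaugeTgt h1
  by_cases h2 : B.gaugeSrc c = B.gaugeSrc d
  swap; · exact separated_by_continuous B.continuous_gaugeSrc h2
  obtain ⟨e, hx, he⟩ := B.exists_trivialization (B.gaugeTgt c)
  obtain ⟨e', hx', he'⟩ := B.exists_trivialization (B.gaugeSrc c)
  set ψ := gaugeTriv e e' he he'
  have hc : c ∈ ψ.source := ⟨hx, hx'⟩
  have hd : d ∈ ψ.source := ⟨h1 ▸ hx, h2 ▸ hx'⟩
  obtain ⟨U, V, hU, hV, hcU, hdV, hUV⟩ := t2_separation (ψ.injOn.ne hc hd hcd)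
  refine ⟨ψ.source ∩ ψ ⁻¹' U, ψ.source ∩ ψ ⁻¹' V, ψ.isOpen_inter_preimage hU,
    ψ.isOpen_inter_preimage hV, ⟨hc, hcU⟩, ⟨hd, hdV⟩, ?_⟩
  exact ((hUV.preimage ψ).inter_left' _).inter_right' _

theorem mdifferentiableAt_arrow (z : P × P) :
    MDifferentiableAt (IP.prod IP) (IM.prod (IG.prod IM)) B.arrow z :=
  (B.contMDiff_arrow z).mdifferentiableAt (by simp)

/-- A local section at `[z]` may pass through another point of the orbit of `z`. Translating it by
the group element that joins the two gives a section through `z`, whose derivative is a right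
inverse. -/
theorem surjective_modelDeriv_arrow (z : P × P) :
    Surjective (modelDeriv (IP.prod IP) (IM.prod (IG.prod IM)) B.arrow z) := by
  obtain ⟨σ, h1, h2⟩ := B.exists_section (B.arrow z)
  obtain ⟨g, hg⟩ := B.arrow_eq_arrow.1 h2.self_of_nhds.symm
  set a : P × P → P × P := fun w => (MulOpposite.op g • w.1, MulOpposite.op g • w.2) with ha
  have d1 : MDifferentiableAt (IP.prod IP) (IP.prod IP) a (σ (B.arrow z)) :=
    ((((B.contMDiff_act_const g).comp contMDiff_fst).prodMk
      ((B.contMDiff_act_const g).comp contMDiff_snd)) _).mdifferentiableAt (by simp)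
  have d2 := h1.mdifferentiableAt (by simp)
  have d3 : MDifferentiableAt _ _ (a ∘ σ) (B.arrow z) := d1.comp (B.arrow z) d2
  intro v
  refine ⟨modelDeriv (IM.prod (IG.prod IM)) (IP.prod IP) (a ∘ σ) (B.arrow z) v, ?_⟩
  rw [← modelDeriv_comp (f := a ∘ σ) hg.symm (B.mdifferentiableAt_arrow z) d3]
  have h3 : B.arrow ∘ (a ∘ σ) =ᶠ[𝓝 (B.arrow z)] id := by
    filter_upwards [h2] with c hc
    exact (B.arrow_act g (σ c)).trans hc
  rw [modelDeriv_congr h3, modelDeriv_id]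

/-- The quotient map is constant along orbits of the diagonal action. The diagonal generators in its
kernel are the freedom used to adjust lifts of composable vectors. -/
theorem modelDeriv_arrow_generator (p q : P) (u : EG) :
    modelDeriv (IP.prod IP) (IM.prod (IG.prod IM)) B.arrow (p, q)
      (B.generatorMap p u, B.generatorMap q u) = 0 := by
  have d1 (p : P) := (B.contMDiff_orbit p 1).mdifferentiableAt (n := ∞) (by simp)
  rw [generatorMap, generatorMap, ← modelDeriv_prodMk (d1 p) (d1 q),
    ← modelDeriv_comp (by simp) (B.mdifferentiableAt_arrow _) ((d1 p).prodMk (d1 q))]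
  have h2 : B.arrow ∘ (fun g : G => (MulOpposite.op g • p, MulOpposite.op g • q)) =
      fun _ => B.arrow (p, q) := funext fun g => B.arrow_act g (p, q)
  rw [h2, modelDeriv_const]

theorem modelDeriv_gaugeSrc_arrow (p q : P) (Z : EP × EP) :
    modelDeriv (IM.prod (IG.prod IM)) IM B.gaugeSrc (B.arrow (p, q))
      (modelDeriv (IP.prod IP) (IM.prod (IG.prod IM)) B.arrow (p, q) Z) =
      modelDeriv IP IM B.proj q Z.2 := by
  rw [← modelDeriv_comp rfl ((B.contMDiff_gaugeSrc _).mdifferentiableAt (by simp))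
    (B.mdifferentiableAt_arrow (p, q))]
  refine (modelDeriv_comp (f := Prod.snd) (g := B.proj) (x := (p, q)) rfl
    ((B.contMDiff_proj _).mdifferentiableAt (by simp)) mdifferentiableAt_snd Z).trans ?_
  rw [modelDeriv_snd]

theorem modelDeriv_gaugeTgt_arrow (p q : P) (Z : EP × EP) :
    modelDeriv (IM.prod (IG.prod IM)) IM B.gaugeTgt (B.arrow (p, q))
      (modelDeriv (IP.prod IP) (IM.prod (IG.prod IM)) B.arrow (p, q) Z) =
      modelDeriv IP IM B.proj p Z.1 := by
  rw [← modelDeriv_comp rfl ((B.contMDiff_gaugeTgt _).mdifferentiableAt (by simp))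
    (B.mdifferentiableAt_arrow (p, q))]
  refine (modelDeriv_comp (f := Prod.fst) (g := B.proj) (x := (p, q)) rfl
    ((B.contMDiff_proj _).mdifferentiableAt (by simp)) mdifferentiableAt_fst Z).trans ?_
  rw [modelDeriv_fst]

end PrincipalBundle
end Gauge

/-! ### The tangent groupoid and multiplicative forms induced from `TP` -/

section Gauge

variable {EM HM EG HG EP HP : Type*}
  [NormedAddCommGroup EM] [NormedSpace ℝ EM] [TopologicalSpace HM]
  [NormedAddCommGroup EG] [NormedSpace ℝ EG] [TopologicalSpace HG]
  [NormedAddCommGroup EP] [NormedSpace ℝ EP] [TopologicalSpace HP]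
  {IM : ModelWithCorners ℝ EM HM} {IG : ModelWithCorners ℝ EG HG} {IP : ModelWithCorners ℝ EP HP}
  {M G P : Type*}
  [TopologicalSpace M] [ChartedSpace HM M] [TopologicalSpace P] [ChartedSpace HP P]
  [TopologicalSpace G] [ChartedSpace HG G] [Group G] [MulAction Gᵐᵒᵖ P]

namespace PrincipalBundle

variable (B : PrincipalBundle IM IG IP M G P)

variable {B} in
/-- The vertical projection `Θ` of a principal connection. -/
def Connection.vert [IsManifold IP ∞ P] (θ : B.Connection) (p : P) : EP →L[ℝ] EP :=
  (B.generatorMap p).comp (θ.toFun p : EP →L[ℝ] EG)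

variable {B} in
theorem Connection.toFun_generatorMap [IsManifold IP ∞ P] (θ : B.Connection) (p : P) (u : EG) :
    (θ.toFun p (B.generatorMap p u) : EG) = u := θ.map_generator u p

variable {B} in
theorem Connection.vert_generatorMap [IsManifold IP ∞ P] (θ : B.Connection) (p : P) (u : EG) :
    θ.vert p (B.generatorMap p u) = B.generatorMap p u :=
  congrArg (B.generatorMap p) (θ.toFun_generatorMap p u)

variable {B} in
theorem Connection.vert_vert [IsManifold IP ∞ P] (θ : B.Connection) (p : P) (X : EP) :
    θ.vert p (θ.vert p X) = θ.vert p X := θ.vert_generatorMap p _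

variable {B} in
theorem Connection.proj_vert [IsManifold IP ∞ P] (θ : B.Connection) (p : P) (X : EP) :
    modelDeriv IP IM B.proj p (θ.vert p X) = 0 := B.modelDeriv_proj_generator p _

variable [LieGroup IG ∞ G] [IsManifold IM ∞ M]

theorem mulExt_arrow (p q r : P) :
    B.gaugeGroupoid.mulExt (B.arrow (p, q), B.arrow (q, r)) = B.arrow (p, r) := by
  have c : B.gaugeGroupoid.src (B.arrow (p, q)) = B.gaugeGroupoid.tgt (B.arrow (q, r)) := rfl
  exact (dif_pos c).trans (B.gaugeMul_arrow p q r)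

/-- The tangent multiplication is `[(X, Y)] [(Y, Z)] = [(X, Z)]`. -/
theorem tangentMul_arrow (p q r : P) (X Y Z : EP) :
    (B.gaugeGroupoid.tangentMul (B.arrow (p, q)) (B.arrow (q, r))
      (modelDeriv (IP.prod IP) (IM.prod (IG.prod IM)) B.arrow (p, q) (X, Y))
      (modelDeriv (IP.prod IP) (IM.prod (IG.prod IM)) B.arrow (q, r) (Y, Z)) : EM × EG × EM) =
      modelDeriv (IP.prod IP) (IM.prod (IG.prod IM)) B.arrow (p, r) (X, Z) := by
  -- The map `s` parametrizes composable pairs, and the multiplication composed with it is `(p, q,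
  -- r) ↦ [(p, r)]`. The formula follows by differentiating this identity.
  set s : P × P × P → B.GaugeSpace × B.GaugeSpace :=
    fun w => (B.arrow (w.1, w.2.1), B.arrow (w.2.1, w.2.2)) with hs
  let w₀ : P × P × P := (p, q, r)
  have hq : MDifferentiableAt (IP.prod (IP.prod IP)) IP (fun w : P × P × P => w.2.1) w₀ :=
    ((contMDiff_fst.comp contMDiff_snd) w₀).mdifferentiableAt (n := ∞) (by simp)
  have hr : MDifferentiableAt (IP.prod (IP.prod IP)) IP (fun w : P × P × P => w.2.2) w₀ :=
    ((contMDiff_snd.comp contMDiff_snd) w₀).mdifferentiableAt (n := ∞) (by simp)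
  have hp : MDifferentiableAt (IP.prod (IP.prod IP)) IP (fun w : P × P × P => w.1) w₀ :=
    mdifferentiableAt_fst
  have ep : modelDeriv (IP.prod (IP.prod IP)) IP (fun w : P × P × P => w.1) w₀ (X, Y, Z) = X :=
    modelDeriv_fst w₀ _
  have eq : modelDeriv (IP.prod (IP.prod IP)) IP (fun w : P × P × P => w.2.1) w₀ (X, Y, Z) = Y := by
    refine (modelDeriv_comp (f := Prod.snd) (g := Prod.fst) rfl mdifferentiableAt_fst
      mdifferentiableAt_snd _).trans ?_
    rw [modelDeriv_fst, modelDeriv_snd]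
  have er : modelDeriv (IP.prod (IP.prod IP)) IP (fun w : P × P × P => w.2.2) w₀ (X, Y, Z) = Z := by
    refine (modelDeriv_comp (f := Prod.snd) (g := Prod.snd) rfl mdifferentiableAt_snd
      mdifferentiableAt_snd _).trans ?_
    rw [modelDeriv_snd, modelDeriv_snd]
  have key : ∀ f g : P × P × P → P, MDifferentiableAt (IP.prod (IP.prod IP)) IP f w₀ →
      MDifferentiableAt (IP.prod (IP.prod IP)) IP g w₀ → ∀ V,
      modelDeriv (IP.prod (IP.prod IP)) (IM.prod (IG.prod IM)) (fun w => B.arrow (f w, g w)) w₀ V =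
        modelDeriv (IP.prod IP) (IM.prod (IG.prod IM)) B.arrow (f w₀, g w₀)
          (modelDeriv (IP.prod (IP.prod IP)) IP f w₀ V,
            modelDeriv (IP.prod (IP.prod IP)) IP g w₀ V) := by
    intro f g hf hg V
    rw [← modelDeriv_prodMk hf hg, ← modelDeriv_comp rfl (B.mdifferentiableAt_arrow _)
      (hf.prodMk hg)]
    rfl
  have ha (f g : P × P × P → P) (hf : MDifferentiableAt (IP.prod (IP.prod IP)) IP f w₀)
      (hg : MDifferentiableAt (IP.prod (IP.prod IP)) IP g w₀) :
      MDifferentiableAt (IP.prod (IP.prod IP)) (IM.prod (IG.prod IM))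
        (fun w => B.arrow (f w, g w)) w₀ :=
    MDifferentiableAt.comp w₀ (B.mdifferentiableAt_arrow _) (hf.prodMk hg)
  have hsd := (ha _ _ hp hq).prodMk (ha _ _ hq hr)
  have hsw : modelDeriv (IP.prod (IP.prod IP))
      ((IM.prod (IG.prod IM)).prod (IM.prod (IG.prod IM))) s w₀ (X, Y, Z) =
      (modelDeriv (IP.prod IP) (IM.prod (IG.prod IM)) B.arrow (p, q) (X, Y),
        modelDeriv (IP.prod IP) (IM.prod (IG.prod IM)) B.arrow (q, r) (Y, Z)) := by
    rw [hs, modelDeriv_prodMk (ha _ _ hp hq) (ha _ _ hq hr), key _ _ hp hq, key _ _ hq hr,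
      ep, eq, er]
  have hm : MDifferentiableWithinAt ((IM.prod (IG.prod IM)).prod (IM.prod (IG.prod IM)))
      (IM.prod (IG.prod IM)) B.gaugeGroupoid.mulExt B.gaugeGroupoid.composable (s w₀) :=
    (B.gaugeGroupoid.contMDiffOn_mul (s w₀) rfl).mdifferentiableWithinAt (by simp)
  -- Since `s` takes values in the composable pairs everywhere, the derivative within that set
  -- composes to an honest derivative. This fixes its values on the image of the derivative of `s`.
  have hc := (hm.hasMFDerivWithinAt.comp w₀ hsd.hasMFDerivAt.hasMFDerivWithinAt
    (fun w (_ : w ∈ univ) => (rfl : B.gaugeSrc (s w).1 = B.gaugeTgt (s w).2))).hasMFDerivAt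
      Filter.univ_mem
  have hms : B.gaugeGroupoid.mulExt ∘ s = fun w => B.arrow (w.1, w.2.2) :=
    funext fun w => B.mulExt_arrow w.1 w.2.1 w.2.2
  have h1 : modelDeriv (IP.prod (IP.prod IP)) (IM.prod (IG.prod IM)) (B.gaugeGroupoid.mulExt ∘ s)
      w₀ (X, Y, Z) = (mfderivWithin ((IM.prod (IG.prod IM)).prod (IM.prod (IG.prod IM)))
      (IM.prod (IG.prod IM)) B.gaugeGroupoid.mulExt B.gaugeGroupoid.composable (s w₀)
      (modelDeriv (IP.prod (IP.prod IP)) ((IM.prod (IG.prod IM)).prod (IM.prod (IG.prod IM))) s w₀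
        (X, Y, Z)) : EM × EG × EM) := DFunLike.congr_fun hc.mfderiv _
  rw [hsw, hms, key _ _ hp hr, ep, er] at h1
  exact h1.symm

theorem modelDeriv_eq_of_tangentComposable {g h : B.GaugeSpace}
    {X : TangentSpace (IM.prod (IG.prod IM)) g} {Y : TangentSpace (IM.prod (IG.prod IM)) h}
    (H : B.gaugeGroupoid.TangentComposable g h X Y) :
    modelDeriv (IM.prod (IG.prod IM)) IM B.gaugeSrc g X =
      modelDeriv (IM.prod (IG.prod IM)) IM B.gaugeTgt h Y :=
  congrArg (fun v : TangentBundle IM M => (v.2 : EM)) H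

/-- A composable pair of tangent vectors is of the form `[(X, Y)]`, `[(Y, Z)]`. -/
theorem exists_composable_lift {p q r : P} {V W : EM × EG × EM}
    (H : modelDeriv (IM.prod (IG.prod IM)) IM B.gaugeSrc (B.arrow (p, q)) V =
      modelDeriv (IM.prod (IG.prod IM)) IM B.gaugeTgt (B.arrow (q, r)) W) :
    ∃ X Y Z : EP, modelDeriv (IP.prod IP) (IM.prod (IG.prod IM)) B.arrow (p, q) (X, Y) = V ∧
      modelDeriv (IP.prod IP) (IM.prod (IG.prod IM)) B.arrow (q, r) (Y, Z) = W := by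
  obtain ⟨⟨X, Y⟩, rfl⟩ := B.surjective_modelDeriv_arrow (p, q) V
  obtain ⟨⟨Y', Z⟩, rfl⟩ := B.surjective_modelDeriv_arrow (q, r) W
  rw [B.modelDeriv_gaugeSrc_arrow, B.modelDeriv_gaugeTgt_arrow] at H
  obtain ⟨u, hu⟩ := B.exists_generator_eq (p := q) (X := Y - Y') (by
    rw [map_sub]; exact sub_eq_zero.2 H)
  -- The two middle components have the same projection, so they differ by a generator `u_P(q)`.
  -- Adding `(u_P(q), u_P(r))`, which `Tq` kills, turns `Y'` into `Y` at the cost of changing `Z`.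
  refine ⟨X, Y, Z + B.generatorMap r u, rfl, ?_⟩
  have h1 : ((Y, Z + B.generatorMap r u) : EP × EP) =
      (Y', Z) + (B.generatorMap q u, B.generatorMap r u) := by
    rw [hu, Prod.mk_add_mk]; simp
  rw [h1, map_add, B.modelDeriv_arrow_generator, add_zero]

variable {B}

/-- A form on the gauge groupoid with vertical values, induced by an operation on `TP`, is
multiplicative. -/
theorem isMultiplicative_of_factors (R : VectorForm (IM.prod (IG.prod IM)) B.GaugeSpace 2)
    (ρ : P → EP → EP → EP)
    (hρ : ∀ p X Y, modelDeriv IP IM B.proj p (ρ p X Y) = 0)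
    (hR : ∀ (p q : P) (X Y : Fin 2 → EP),
      (R (B.arrow (p, q)) (fun i => modelDeriv (IP.prod IP) (IM.prod (IG.prod IM)) B.arrow (p, q)
        (X i, Y i)) : EM × EG × EM) =
      modelDeriv (IP.prod IP) (IM.prod (IG.prod IM)) B.arrow (p, q)
        (ρ p (X 0) (X 1), ρ q (Y 0) (Y 1))) :
    B.gaugeGroupoid.IsMultiplicative R := by
  have lift : ∀ (p q : P) (V : Fin 2 → EM × EG × EM), ∃ X Y : Fin 2 → EP,
      V = fun i => modelDeriv (IP.prod IP) (IM.prod (IG.prod IM)) B.arrow (p, q) (X i, Y i) := by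
    intro p q V
    choose Z hZ using fun i => B.surjective_modelDeriv_arrow (p, q) (V i)
    exact ⟨fun i => (Z i).1, fun i => (Z i).2, funext fun i => (hZ i).symm⟩
  -- The values of `R` are images of pairs of vertical vectors, so source and target annihilate them
  -- and the base form must vanish.
  refine ⟨VectorForm.zero 2, ?_, ?_, ?_⟩
  · intro g V
    obtain ⟨⟨p, q⟩, rfl⟩ := B.arrow_surjective g
    obtain ⟨X, Y, rfl⟩ := lift p q V
    refine Eq.trans (b := modelDeriv (IM.prod (IG.prod IM)) IM B.gaugeSrc (B.arrow (p, q))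
      (modelDeriv (IP.prod IP) (IM.prod (IG.prod IM)) B.arrow (p, q)
        (ρ p (X 0) (X 1), ρ q (Y 0) (Y 1)))) (congrArg _ (hR p q X Y)) ?_
    rw [B.modelDeriv_gaugeSrc_arrow, hρ]
    rfl
  · intro g V
    obtain ⟨⟨p, q⟩, rfl⟩ := B.arrow_surjective g
    obtain ⟨X, Y, rfl⟩ := lift p q V
    refine Eq.trans (b := modelDeriv (IM.prod (IG.prod IM)) IM B.gaugeTgt (B.arrow (p, q))
      (modelDeriv (IP.prod IP) (IM.prod (IG.prod IM)) B.arrow (p, q)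
        (ρ p (X 0) (X 1), ρ q (Y 0) (Y 1)))) (congrArg _ (hR p q X Y)) ?_
    rw [B.modelDeriv_gaugeTgt_arrow, hρ]
    rfl
  · intro g h V W hgh hVW
    obtain ⟨⟨p, q⟩, rfl⟩ := B.arrow_surjective g
    obtain ⟨r, rfl⟩ : ∃ r, h = B.arrow (q, r) :=
      B.exists_arrow_eq (g := B.arrow (p, q)) (h := h) hgh (p, q) rfl
    choose X Y Z hXY hYZ using fun i =>
      B.exists_composable_lift (B.modelDeriv_eq_of_tangentComposable (hVW i))
    obtain rfl : (fun i => modelDeriv (IP.prod IP) (IM.prod (IG.prod IM)) B.arrow (p, q)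
      (X i, Y i)) = V := funext hXY
    obtain rfl : (fun i => modelDeriv (IP.prod IP) (IM.prod (IG.prod IM)) B.arrow (q, r)
      (Y i, Z i)) = W := funext hYZ
    -- The product arrow equals `[(p, r)]` only propositionally. Generalizing it to `c` permits
    -- moving between the two tangent spaces by substitution.
    have e1 : ∀ c, B.gaugeGroupoid.mulExt (B.arrow (p, q), B.arrow (q, r)) = c →
        ∀ v w : Fin 2 → EM × EG × EM, v = w →
        (R (B.gaugeGroupoid.mulExt (B.arrow (p, q), B.arrow (q, r))) v : EM × EG × EM) = R c w := by
      rintro _ rfl _ _ rfl; rfl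
    refine (e1 _ (B.mulExt_arrow p q r) _ _
      (funext fun i => B.tangentMul_arrow p q r (X i) (Y i) (Z i))).trans ?_
    refine (hR p r X Z).trans ?_
    -- The values of `R` on the two factors share the middle component `ρ(Y₀, Y₁)`, because the
    -- lifts share `Y`.
    refine (B.tangentMul_arrow p q r _ (ρ q (Y 0) (Y 1)) _).symm.trans ?_
    have e2 : ∀ v v' w w' : EM × EG × EM, v = v' → w = w' →
        B.gaugeGroupoid.tangentMul (B.arrow (p, q)) (B.arrow (q, r)) v w =
          B.gaugeGroupoid.tangentMul (B.arrow (p, q)) (B.arrow (q, r)) v' w' := by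
      rintro _ _ _ _ rfl rfl; rfl
    exact e2 _ _ _ _ (hR p q X Y).symm (hR q r Y Z).symm

variable [IsManifold IP ∞ P]

theorem Connection.Induces.endo_arrow {θ : B.Connection}
    {K : VectorForm (IM.prod (IG.prod IM)) B.GaugeSpace 1} (hK : θ.Induces K) (p q : P)
    (X Y : EP) :
    K.endo (B.arrow (p, q)) (modelDeriv (IP.prod IP) (IM.prod (IG.prod IM)) B.arrow (p, q) (X, Y)) =
      modelDeriv (IP.prod IP) (IM.prod (IG.prod IM)) B.arrow (p, q) (θ.vert p X, θ.vert q Y) :=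
  hK p q X Y

/-- Every tangent vector is some `[(X, Y)]`, so idempotence is inherited from `Θ` on both
components. -/
theorem Connection.Induces.endo_endo {θ : B.Connection}
    {K : VectorForm (IM.prod (IG.prod IM)) B.GaugeSpace 1} (hK : θ.Induces K) (c : B.GaugeSpace)
    (v : TangentSpace (IM.prod (IG.prod IM)) c) : K.endo c (K.endo c v) = K.endo c v := by
  obtain ⟨⟨p, q⟩, rfl⟩ := B.arrow_surjective c
  obtain ⟨⟨X, Y⟩, rfl⟩ := B.surjective_modelDeriv_arrow (p, q) v
  rw [hK.endo_arrow]
  refine (hK.endo_arrow p q _ _).trans ?_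
  rw [θ.vert_vert, θ.vert_vert]

end PrincipalBundle
end Gauge

/-! ### Smoothness of vector fields along maps -/

section FieldTools

variable {E E' E'' H H' H'' N N' N'' : Type*}
  [NormedAddCommGroup E] [NormedSpace ℝ E] [TopologicalSpace H] {I : ModelWithCorners ℝ E H}
  [NormedAddCommGroup E'] [NormedSpace ℝ E'] [TopologicalSpace H'] {I' : ModelWithCorners ℝ E' H'}
  [TopologicalSpace N] [ChartedSpace H N] [TopologicalSpace N'] [ChartedSpace H' N']

theorem tangentBundle_mk_eq_mk {x y : N} (h : x = y) {v : TangentSpace I x} {w : TangentSpace I y}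
    (hvw : (v : E) = (w : E)) : (⟨x, v⟩ : TangentBundle I N) = ⟨y, w⟩ := by
  subst h
  exact congrArg (fun v : TangentSpace I x => (⟨x, v⟩ : TangentBundle I N)) hvw

variable [IsManifold I ∞ N] [IsManifold I' ∞ N'] {Q : Type*} {EQ HQ : Type*}
  [NormedAddCommGroup EQ] [NormedSpace ℝ EQ] [TopologicalSpace HQ] {IQ : ModelWithCorners ℝ EQ HQ}
  [TopologicalSpace Q] [ChartedSpace HQ Q]

theorem contMDiffOn_tangentBundle_prodMk {U : Set Q} {f : Q → N} {g : Q → N'} {v : Q → E}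
    {w : Q → E'}
    (hf : ContMDiffOn IQ I.tangent ∞ (fun y => (⟨f y, v y⟩ : TangentBundle I N)) U)
    (hg : ContMDiffOn IQ I'.tangent ∞ (fun y => (⟨g y, w y⟩ : TangentBundle I' N')) U) :
    ContMDiffOn IQ (I.prod I').tangent ∞
      (fun y => (⟨(f y, g y), (v y, w y)⟩ : TangentBundle (I.prod I') (N × N'))) U :=
  contMDiff_equivTangentBundleProd_symm.comp_contMDiffOn (hf.prodMk hg)

/-- The tangent map of a smooth map is smooth. The vectors are taken along a map `g` from a third
manifold so that push-forwards through local sections and trivializations are covered. -/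
theorem contMDiffOn_modelDeriv {f : N → N'} {S : Set N} (hS : IsOpen S)
    (hf : ContMDiffOn I I' ∞ f S) {U : Set Q} {g : Q → N} {v : Q → E}
    (hg : ContMDiffOn IQ I.tangent ∞ (fun y => (⟨g y, v y⟩ : TangentBundle I N)) U)
    (hgS : ∀ y ∈ U, g y ∈ S) :
    ContMDiffOn IQ I'.tangent ∞
      (fun y => (⟨f (g y), modelDeriv I I' f (g y) (v y)⟩ : TangentBundle I' N')) U := by
  have : IsManifold I 1 N := IsManifold.of_le (n := ∞) (by simp)
  have : IsManifold I' 1 N' := IsManifold.of_le (n := ∞) (by simp)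
  refine ((hf.contMDiffOn_tangentMapWithin (m := ∞) le_rfl hS.uniqueMDiffOn).comp hg
    (fun y hy => hgS y hy)).congr fun y hy => ?_
  refine tangentBundle_mk_eq_mk rfl ?_
  change _ = mfderivWithin I I' f S (g y) (v y)
  rw [mfderivWithin_of_isOpen hS (hgS y hy)]
  rfl

end FieldTools

/-! ### Invariant lifts of vector fields, and fields of infinitesimal generators -/

section Gauge

variable {EM HM EG HG EP HP : Type*}
  [NormedAddCommGroup EM] [NormedSpace ℝ EM] [TopologicalSpace HM]
  [NormedAddCommGroup EG] [NormedSpace ℝ EG] [TopologicalSpace HG]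
  [NormedAddCommGroup EP] [NormedSpace ℝ EP] [TopologicalSpace HP]
  {IM : ModelWithCorners ℝ EM HM} {IG : ModelWithCorners ℝ EG HG} {IP : ModelWithCorners ℝ EP HP}
  {M G P : Type*}
  [TopologicalSpace M] [ChartedSpace HM M] [TopologicalSpace P] [ChartedSpace HP P]
  [TopologicalSpace G] [ChartedSpace HG G] [Group G] [MulAction Gᵐᵒᵖ P]

namespace PrincipalBundle

variable {B : PrincipalBundle IM IG IP M G P}

/-- The lift of a vector field `w` on the base to the total space, in a trivialization `e`. -/
def liftField (e : Trivialization G B.proj) (w : M → EM) (p : P) : EP :=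
  modelDeriv (IM.prod IG) IP e.toOpenPartialHomeomorph.symm (e p) (w (B.proj p), 0)

variable {e : Trivialization G B.proj}

theorem proj_liftField (he : IsPrincipalTrivialization IM IG IP e)
    {p : P} (hp : p ∈ e.source) (w : M → EM) :
    modelDeriv IP IM B.proj p (liftField (IM := IM) (IG := IG) (IP := IP) e w p) = w (B.proj p) := by
  have hy : e p ∈ e.target := e.map_source hp
  rw [liftField, ← modelDeriv_comp (x := e p) (e.toOpenPartialHomeomorph.left_inv hp)
    ((B.contMDiff_proj p).mdifferentiableAt (by simp)) (he.mdifferentiableAt_symm hy)]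
  have h : B.proj ∘ e.toOpenPartialHomeomorph.symm =ᶠ[𝓝 (e p)] Prod.fst :=
    Filter.eventuallyEq_of_mem (e.open_target.mem_nhds hy) fun y hy => e.proj_symm_apply hy
  rw [modelDeriv_congr h, modelDeriv_fst]

/-- In the trivialization the action is right translation of the `G`-component. This preserves
vectors of the form `(w, 0)`, so the lift is an invariant field. -/
theorem act_liftField [LieGroup IG ∞ G]
    (he : IsPrincipalTrivialization IM IG IP e) {p : P} (hp : p ∈ e.source) (w : M → EM) (a : G) :
    modelDeriv IP IP (fun q : P => MulOpposite.op a • q) p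
        (liftField (IM := IM) (IG := IG) (IP := IP) e w p) =
      liftField (IM := IM) (IG := IG) (IP := IP) e w (MulOpposite.op a • p) := by
  have hy : e p ∈ e.target := e.map_source hp
  have hpa : MulOpposite.op a • p ∈ e.source := e.mem_source.2 (by
    rw [B.proj_act]; exact e.mem_source.1 hp)
  set r : M × G → M × G := fun y => (y.1, y.2 * a) with hr
  have hrp : r (e p) = e (MulOpposite.op a • p) := by
    refine Prod.ext ?_ (he.map_act p hp a).symm
    exact (e.coe_fst hp).trans ((B.proj_act p a).symm.trans (e.coe_fst hpa).symm)
  have dr2 : MDifferentiableAt (IM.prod IG) IG (fun y : M × G => y.2 * a) (e p) :=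
    (((contMDiff_mul_right (I := IG) (n := ∞) (a := a)).comp contMDiff_snd) _).mdifferentiableAt
      (by simp)
  have dr : MDifferentiableAt (IM.prod IG) (IM.prod IG) r (e p) :=
    mdifferentiableAt_fst.prodMk dr2
  rw [liftField, ← modelDeriv_comp (f := e.toOpenPartialHomeomorph.symm) (x := e p)
    (e.toOpenPartialHomeomorph.left_inv hp)
    ((B.contMDiff_act_const a p).mdifferentiableAt (by simp)) (he.mdifferentiableAt_symm hy)]
  have h : (fun q : P => MulOpposite.op a • q) ∘ e.toOpenPartialHomeomorph.symm =ᶠ[𝓝 (e p)]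
      e.toOpenPartialHomeomorph.symm ∘ r := by
    refine Filter.eventuallyEq_of_mem (e.open_target.mem_nhds hy) fun y hy => ?_
    have hys : e.toOpenPartialHomeomorph.symm y ∈ e.source := e.map_target hy
    have hb : B.proj (e.toOpenPartialHomeomorph.symm y) = y.1 := e.proj_symm_apply hy
    have h1 : MulOpposite.op a • e.toOpenPartialHomeomorph.symm y ∈ e.source :=
      e.mem_source.2 (by rw [B.proj_act]; exact e.mem_source.1 hys)
    refine (e.toOpenPartialHomeomorph.left_inv h1).symm.trans ?_
    refine congrArg e.toOpenPartialHomeomorph.symm (Prod.ext ?_ ?_)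
    · exact (e.coe_fst h1).trans ((B.proj_act _ a).trans hb)
    · refine (he.map_act _ hys a).trans ?_
      exact congrArg (fun z : M × G => z.2 * a) (e.toOpenPartialHomeomorph.right_inv hy)
  rw [modelDeriv_congr h, modelDeriv_comp hrp (he.mdifferentiableAt_symm (e.map_source hpa)) dr,
    liftField]
  refine congrArg (modelDeriv (IM.prod IG) IP e.toOpenPartialHomeomorph.symm _) ?_
  rw [hr, modelDeriv_prodMk mdifferentiableAt_fst dr2, B.proj_act]
  refine Prod.ext (modelDeriv_fst _ _) ?_
  refine (modelDeriv_comp (f := Prod.snd) (g := fun g : G => g * a) rfl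
    ((contMDiff_mul_right (I := IG) (n := ∞) (a := a) _).mdifferentiableAt (by simp))
    mdifferentiableAt_snd _).trans ?_
  rw [modelDeriv_snd]
  exact map_zero _

theorem smoothFieldOn_liftField [IsManifold IP ∞ P] [IsManifold IM ∞ M] [IsManifold IG ∞ G]
    (he : IsPrincipalTrivialization IM IG IP e) {w : M → EM} {s : Set M} (hs : s ⊆ e.baseSet)
    (hw : SmoothFieldOn IM M w s) :
    SmoothFieldOn IP P (liftField (IM := IM) (IG := IG) (IP := IP) e w) (B.proj ⁻¹' s) := by
  have hsrc : ∀ p ∈ B.proj ⁻¹' s, p ∈ e.source := fun p hp => e.mem_source.2 (hs hp)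
  have h1 : ContMDiffOn IP IM.tangent ∞
      (fun p => (⟨B.proj p, w (B.proj p)⟩ : TangentBundle IM M)) (B.proj ⁻¹' s) :=
    ContMDiffOn.comp hw B.contMDiff_proj.contMDiffOn fun _ hp => hp
  have h2 : ContMDiffOn IP IG.tangent ∞
      (fun p => (⟨(e p).2, 0⟩ : TangentBundle IG G)) (B.proj ⁻¹' s) :=
    (contMDiff_zeroSection ℝ (TangentSpace IG : G → Type _)).comp_contMDiffOn
      (contMDiff_snd.comp_contMDiffOn (he.contMDiffOn.mono hsrc))
  have h3 := contMDiffOn_modelDeriv e.open_target he.contMDiffOn_symm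
    (contMDiffOn_tangentBundle_prodMk h1 h2) fun p hp => e.mem_target.2 (hs hp)
  refine h3.congr fun p hp => ?_
  have hep : e p = (B.proj p, (e p).2) := Prod.ext (e.coe_fst (hsrc p hp)) rfl
  refine tangentBundle_mk_eq_mk ?_ ?_
  · rw [← hep]
    exact (e.toOpenPartialHomeomorph.left_inv (hsrc p hp)).symm
  · change liftField e w p = modelDeriv (IM.prod IG) IP e.toOpenPartialHomeomorph.symm
      (B.proj p, (e p).2) (w (B.proj p), 0)
    rw [liftField, ← hep]

/-- The infinitesimal generators given by a smooth function with values in the Lie algebra form a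
smooth vector field. -/
theorem smoothFieldOn_generatorMap [IsManifold IP ∞ P] [IsManifold IG ∞ G]
    [FiniteDimensional ℝ EG]
    {u : P → EG} {U : Set P} (hu : ContMDiffOn IP 𝓘(ℝ, EG) ∞ u U) :
    SmoothFieldOn IP P (fun p => B.generatorMap p (u p)) U := by
  -- For constant `c` the generator at `p` is the derivative of the action at `(p, 1)` applied to
  -- `(0, c)`. A general `u` is then expanded in a basis of the Lie algebra.
  have h0 : ∀ c : EG, SmoothFieldOn IP P (fun p => B.generatorMap p c) univ := by
    intro c
    have h1 : ContMDiffOn IP IP.tangent ∞ (fun p => (⟨p, 0⟩ : TangentBundle IP P)) univ :=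
      (contMDiff_zeroSection ℝ (TangentSpace IP : P → Type _)).contMDiffOn
    have h2 : ContMDiffOn IP IG.tangent ∞ (fun _ : P => (⟨1, c⟩ : TangentBundle IG G)) univ :=
      contMDiffOn_const
    refine (contMDiffOn_modelDeriv isOpen_univ B.contMDiff_act.contMDiffOn
      (contMDiffOn_tangentBundle_prodMk h1 h2) fun _ _ => mem_univ _).congr fun p _ => ?_
    refine tangentBundle_mk_eq_mk (one_smul _ p).symm ?_
    change modelDeriv IG IP ((fun x : P × G => MulOpposite.op x.2 • x.1) ∘ fun g : G => (p, g)) 1 c =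
      modelDeriv (IP.prod IG) IP (fun x : P × G => MulOpposite.op x.2 • x.1) (p, 1) (0, c)
    rw [modelDeriv_comp (f := fun g : G => (p, g)) (x := 1) rfl
      ((B.contMDiff_act _).mdifferentiableAt (by simp))
      (mdifferentiableAt_const.prodMk mdifferentiableAt_id),
      modelDeriv_prodMk (g := fun g : G => g) mdifferentiableAt_const mdifferentiableAt_id,
      modelDeriv_const]
    refine congrArg (fun d => modelDeriv (IP.prod IG) IP _ (p, 1) (0, d)) ?_
    exact modelDeriv_id (1 : G) c
  let b := Module.finBasis ℝ EG
  have h3 : ContMDiffOn IP IP.tangent ∞ (fun p => (⟨p, ∑ i, b.repr (u p) i •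
      (B.generatorMap p (b i) : TangentSpace IP p)⟩ : TangentBundle IP P)) U := by
    refine ContMDiffOn.sum_section fun i _ => ContMDiffOn.smul_section ?_
      ((h0 (b i)).mono (subset_univ _))
    let l : EG →L[ℝ] ℝ := LinearMap.toContinuousLinearMap (b.coord i)
    exact l.contMDiff.comp_contMDiffOn hu
  refine h3.congr fun p _ => tangentBundle_mk_eq_mk rfl ?_
  have h4 := congrArg (B.generatorMap p) (b.sum_repr (u p))
  rw [map_sum] at h4
  simp only [map_smul] at h4
  exact h4.symm

end PrincipalBundle
end Gauge

/-! ### Horizontal lifts and the fields they induce on the gauge groupoid -/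

section Gauge

variable {EM HM EG HG EP HP : Type*}
  [NormedAddCommGroup EM] [NormedSpace ℝ EM] [TopologicalSpace HM]
  [NormedAddCommGroup EG] [NormedSpace ℝ EG] [TopologicalSpace HG]
  [NormedAddCommGroup EP] [NormedSpace ℝ EP] [TopologicalSpace HP]
  {IM : ModelWithCorners ℝ EM HM} {IG : ModelWithCorners ℝ EG HG} {IP : ModelWithCorners ℝ EP HP}
  {M G P : Type*}
  [TopologicalSpace M] [ChartedSpace HM M] [TopologicalSpace P] [ChartedSpace HP P]
  [TopologicalSpace G] [ChartedSpace HG G] [Group G] [MulAction Gᵐᵒᵖ P]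

namespace PrincipalBundle

variable {B : PrincipalBundle IM IG IP M G P} {e e' : Trivialization G B.proj}

section HorizontalLift

variable [IsManifold IP ∞ P] (θ : B.Connection)

/-- The horizontal lift of a vector field `w` on the base, computed in a trivialization `e`. -/
def Connection.hlift (e : Trivialization G B.proj) (w : M → EM) (p : P) : EP :=
  liftField (IM := IM) (IG := IG) (IP := IP) e w p -
    θ.vert p (liftField (IM := IM) (IG := IG) (IP := IP) e w p)

theorem Connection.smoothFieldOn_hlift [IsManifold IM ∞ M] [IsManifold IG ∞ G]
    [FiniteDimensional ℝ EG] (he : IsPrincipalTrivialization IM IG IP e) {w : M → EM} {s : Set M}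
    (hs : IsOpen s) (hse : s ⊆ e.baseSet) (hw : SmoothFieldOn IM M w s) :
    SmoothFieldOn IP P (θ.hlift e w) (B.proj ⁻¹' s) := by
  have h1 := smoothFieldOn_liftField he hse hw
  have h2 := θ.smooth' _ (hs.preimage B.contMDiff_proj.continuous) _ h1
  exact ContMDiffOn.sub_section h1 (smoothFieldOn_generatorMap (B := B) h2)

/-- The horizontal part of a vector is the horizontal lift of its projection. -/
theorem Connection.sub_vert_eq_hlift [LieGroup IG ∞ G]
    (he : IsPrincipalTrivialization IM IG IP e) {p : P} (hp : p ∈ e.source) {w : M → EM} {X : EP}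
    (hX : modelDeriv IP IM B.proj p X = w (B.proj p)) : X - θ.vert p X = θ.hlift e w p := by
  -- The difference of `X` and the lift is vertical, hence a generator, hence fixed by `Θ`; so the
  -- two have the same horizontal part.
  have h1 : modelDeriv IP IM B.proj p (X - liftField (IM := IM) (IG := IG) (IP := IP) e w p) = 0 := by
    rw [map_sub, hX, proj_liftField he hp, sub_self]
  obtain ⟨u, hu⟩ := B.exists_generator_eq h1
  have h2 := θ.vert_generatorMap p u
  rw [hu, map_sub] at h2
  rw [Connection.hlift, sub_eq_sub_iff_sub_eq_sub]
  exact h2.symm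

end HorizontalLift

variable [LieGroup IG ∞ G] [IsManifold IM ∞ M]

/-- The vector field on the gauge groupoid induced by the lifts of vector fields on the base. -/
def gaugeField (he : IsPrincipalTrivialization IM IG IP e)
    (he' : IsPrincipalTrivialization IM IG IP e') (w w' : M → EM) (c : B.GaugeSpace) :
    EM × EG × EM :=
  modelDeriv (IP.prod IP) (IM.prod (IG.prod IM)) B.arrow (locSec e e' (gaugeTriv e e' he he' c))
    (liftField (IM := IM) (IG := IG) (IP := IP) e w (locSec e e' (gaugeTriv e e' he he' c)).1,
      liftField (IM := IM) (IG := IG) (IP := IP) e' w' (locSec e e' (gaugeTriv e e' he he' c)).2)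

/-- The definition evaluates the lifts at one representative of the class. As the lifts are
invariant and `q` is constant on orbits, any representative serves, and the field is `q`-related to
the pair of lifts. -/
theorem gaugeField_arrow (he : IsPrincipalTrivialization IM IG IP e)
    (he' : IsPrincipalTrivialization IM IG IP e') (w w' : M → EM) {z : P × P}
    (hz : z ∈ locDom e e') :
    gaugeField he he' w w' (B.arrow z) =
      modelDeriv (IP.prod IP) (IM.prod (IG.prod IM)) B.arrow z
        (liftField (IM := IM) (IG := IG) (IP := IP) e w z.1,
          liftField (IM := IM) (IG := IG) (IP := IP) e' w' z.2) := by
  obtain ⟨g, hg⟩ := B.arrow_eq_arrow.1 (arrow_locSec_locTriv he he' hz.1 hz.2)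
  set a : P × P → P × P := fun w => (MulOpposite.op g • w.1, MulOpposite.op g • w.2) with ha
  have d1 : MDifferentiableAt (IP.prod IP) IP (fun w : P × P => MulOpposite.op g • w.1) z :=
    ((B.contMDiff_act_const g).comp contMDiff_fst z).mdifferentiableAt (by simp)
  have d2 : MDifferentiableAt (IP.prod IP) IP (fun w : P × P => MulOpposite.op g • w.2) z :=
    ((B.contMDiff_act_const g).comp contMDiff_snd z).mdifferentiableAt (by simp)
  have h1 : B.arrow ∘ a = B.arrow := funext fun w => B.arrow_act g w
  have h2 (V : EP × EP) : modelDeriv (IP.prod IP) (IP.prod IP) a z V =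
      (modelDeriv IP IP (fun p : P => MulOpposite.op g • p) z.1 V.1,
        modelDeriv IP IP (fun p : P => MulOpposite.op g • p) z.2 V.2) := by
    rw [ha, modelDeriv_prodMk d1 d2]
    refine Prod.ext ?_ ?_
    · refine (modelDeriv_comp (f := Prod.fst) (g := fun p : P => MulOpposite.op g • p) rfl
        ((B.contMDiff_act_const g _).mdifferentiableAt (by simp)) mdifferentiableAt_fst V).trans ?_
      rw [modelDeriv_fst]
    · refine (modelDeriv_comp (f := Prod.snd) (g := fun p : P => MulOpposite.op g • p) rfl
        ((B.contMDiff_act_const g _).mdifferentiableAt (by simp)) mdifferentiableAt_snd V).trans ?_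
      rw [modelDeriv_snd]
  rw [gaugeField, gaugeTriv_arrow he he' hz, hg,
    ← act_liftField he (e.mem_source.2 hz.1), ← act_liftField he' (e'.mem_source.2 hz.2)]
  refine (congrArg _ (h2 (_, _)).symm).trans ?_
  rw [← modelDeriv_comp (f := a) rfl (B.mdifferentiableAt_arrow _) (d1.prodMk d2), h1]
  rfl

theorem smoothFieldOn_gaugeField [IsManifold IP ∞ P] (he : IsPrincipalTrivialization IM IG IP e)
    (he' : IsPrincipalTrivialization IM IG IP e') {w w' : M → EM} {s s' : Set M}
    (hs : s ⊆ e.baseSet) (hs' : s' ⊆ e'.baseSet)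
    (hw : SmoothFieldOn IM M w s) (hw' : SmoothFieldOn IM M w' s') :
    SmoothFieldOn (IM.prod (IG.prod IM)) B.GaugeSpace (gaugeField he he' w w')
      (B.gaugeTgt ⁻¹' s ∩ B.gaugeSrc ⁻¹' s') := by
  have : IsManifold IG ∞ G := ‹LieGroup IG ∞ G›.toContMDiffMul.toIsManifold
  set O := B.gaugeTgt ⁻¹' s ∩ B.gaugeSrc ⁻¹' s' with hO
  have hOs : ∀ c ∈ O, c ∈ (gaugeTriv e e' he he').source := fun c hc => ⟨hs hc.1, hs' hc.2⟩
  have hinv : ∀ c ∈ O, B.arrow (locSec e e' (gaugeTriv e e' he he' c)) = c := fun c hc =>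
    (gaugeTriv e e' he he').left_inv (hOs c hc)
  have hσ : ContMDiffOn (IM.prod (IG.prod IM)) (IP.prod IP) ∞
      (fun c => locSec e e' (gaugeTriv e e' he he' c)) O :=
    (contMDiffOn_locSec he he').comp ((contMDiffOn_gaugeTriv he he').mono hOs)
      fun c hc => (gaugeTriv e e' he he').map_source (hOs c hc)
  have hσ1 : ∀ c ∈ O, (locSec e e' (gaugeTriv e e' he he' c)).1 ∈ B.proj ⁻¹' s := fun c hc => by
    rw [mem_preimage, ← B.gaugeTgt_arrow, hinv c hc]; exact hc.1
  have hσ2 : ∀ c ∈ O, (locSec e e' (gaugeTriv e e' he he' c)).2 ∈ B.proj ⁻¹' s' := fun c hc => by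
    rw [mem_preimage, ← B.gaugeSrc_arrow, hinv c hc]; exact hc.2
  have h1 := (smoothFieldOn_liftField he hs hw).comp (contMDiff_fst.comp_contMDiffOn hσ) hσ1
  have h2 := (smoothFieldOn_liftField he' hs' hw').comp (contMDiff_snd.comp_contMDiffOn hσ) hσ2
  refine (contMDiffOn_modelDeriv isOpen_univ B.contMDiff_arrow.contMDiffOn
    (contMDiffOn_tangentBundle_prodMk h1 h2) fun _ _ => mem_univ _).congr fun c hc => ?_
  exact tangentBundle_mk_eq_mk (hinv c hc).symm rfl

variable [IsManifold IP ∞ P]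

theorem Connection.Induces.compl_arrow {θ : B.Connection}
    {K : VectorForm (IM.prod (IG.prod IM)) B.GaugeSpace 1} (hK : θ.Induces K) (z : P × P)
    (X Y : EP) :
    K.compl (B.arrow z) (modelDeriv (IP.prod IP) (IM.prod (IG.prod IM)) B.arrow z (X, Y)) =
      modelDeriv (IP.prod IP) (IM.prod (IG.prod IM)) B.arrow z
        (X - θ.vert z.1 X, Y - θ.vert z.2 Y) := by
  refine (congrArg (fun d : EM × EG × EM =>
    modelDeriv (IP.prod IP) (IM.prod (IG.prod IM)) B.arrow z (X, Y) - d)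
      (hK.endo_arrow z.1 z.2 X Y)).trans ?_
  exact (map_sub (modelDeriv (IP.prod IP) (IM.prod (IG.prod IM)) B.arrow z) (X, Y)
    (θ.vert z.1 X, θ.vert z.2 Y)).symm

/-- On `P × P`, `Id - K` corresponds to `Id - Θ` on both factors, which turns the lifts into
horizontal lifts. This is the relatedness through which brackets on the gauge groupoid are computed
on `P × P`. -/
theorem Connection.Induces.compl_gaugeField {θ : B.Connection}
    {K : VectorForm (IM.prod (IG.prod IM)) B.GaugeSpace 1} (hK : θ.Induces K)
    (he : IsPrincipalTrivialization IM IG IP e)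
    (he' : IsPrincipalTrivialization IM IG IP e') (w w' : M → EM) {z : P × P}
    (hz : z ∈ locDom e e') :
    K.compl (B.arrow z) (gaugeField he he' w w' (B.arrow z)) =
      modelDeriv (IP.prod IP) (IM.prod (IG.prod IM)) B.arrow z
        (θ.hlift e w z.1, θ.hlift e' w' z.2) := by
  rw [gaugeField_arrow he he' w w' hz]
  exact hK.compl_arrow z _ _

variable [IM.Boundaryless] [IG.Boundaryless] [IP.Boundaryless]
  [FiniteDimensional ℝ EM] [FiniteDimensional ℝ EG] [FiniteDimensional ℝ EP]

/-- The value of the curvature of `K` on the fields induced by lifts of vector fields. -/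
theorem Connection.Induces.curvatureOp_gaugeField {θ : B.Connection}
    {K : VectorForm (IM.prod (IG.prod IM)) B.GaugeSpace 1} (hK : θ.Induces K)
    (he : IsPrincipalTrivialization IM IG IP e)
    (he' : IsPrincipalTrivialization IM IG IP e') {v w v' w' : M → EM} {s s' : Set M}
    (hs : s ⊆ e.baseSet) (hs' : s' ⊆ e'.baseSet) (ho : IsOpen s) (ho' : IsOpen s')
    (hv : SmoothFieldOn IM M v s) (hw : SmoothFieldOn IM M w s)
    (hv' : SmoothFieldOn IM M v' s') (hw' : SmoothFieldOn IM M w' s') {z : P × P}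
    (hz : B.proj z.1 ∈ s) (hz' : B.proj z.2 ∈ s') :
    K.curvatureOp (B.arrow z) (gaugeField he he' v v') (gaugeField he he' w w') =
      modelDeriv (IP.prod IP) (IM.prod (IG.prod IM)) B.arrow z
        (θ.vert z.1 (VectorField.mlieBracket IP (θ.hlift e v) (θ.hlift e w) z.1),
          θ.vert z.2 (VectorField.mlieBracket IP (θ.hlift e' v') (θ.hlift e' w') z.2)) := by
  have : IsManifold IG ∞ G := ‹LieGroup IG ∞ G›.toContMDiffMul.toIsManifold
  have : CompleteSpace EP := FiniteDimensional.complete ℝ EP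
  have : CompleteSpace EM := FiniteDimensional.complete ℝ EM
  have : CompleteSpace EG := FiniteDimensional.complete ℝ EG
  have hc := B.contMDiff_proj.continuous
  have n1 : B.proj ⁻¹' s ∈ 𝓝 z.1 := (ho.preimage hc).mem_nhds hz
  have n2 : B.proj ⁻¹' s' ∈ 𝓝 z.2 := (ho'.preimage hc).mem_nhds hz'
  have n3 : (B.proj ⁻¹' s) ×ˢ (B.proj ⁻¹' s') ∈ 𝓝 z := prod_mem_nhds n1 n2
  have n4 : B.gaugeTgt ⁻¹' s ∩ B.gaugeSrc ⁻¹' s' ∈ 𝓝 (B.arrow z) :=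
    Filter.inter_mem ((ho.preimage B.continuous_gaugeTgt).mem_nhds hz)
      ((ho'.preimage B.continuous_gaugeSrc).mem_nhds hz')
  have dG : ∀ {v v' : M → EM}, SmoothFieldOn IM M v s → SmoothFieldOn IM M v' s' →
      MDifferentiableAt (IM.prod (IG.prod IM)) (IM.prod (IG.prod IM)).tangent
        (fun c => (⟨c, K.compl c (gaugeField he he' v v' c)⟩ :
          TangentBundle (IM.prod (IG.prod IM)) B.GaugeSpace)) (B.arrow z) := fun hv hv' =>
    K.mdifferentiableAt_compl
      (((smoothFieldOn_gaugeField he he' hs hs' hv hv').contMDiffAt n4).mdifferentiableAt (by simp))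
  have d1 : ∀ {v : M → EM}, SmoothFieldOn IM M v s → MDifferentiableAt IP IP.tangent
      (fun p => (⟨p, θ.hlift e v p⟩ : TangentBundle IP P)) z.1 := fun hv =>
    ((θ.smoothFieldOn_hlift he ho hs hv).contMDiffAt n1).mdifferentiableAt (by simp)
  have d2 : ∀ {v : M → EM}, SmoothFieldOn IM M v s' → MDifferentiableAt IP IP.tangent
      (fun p => (⟨p, θ.hlift e' v p⟩ : TangentBundle IP P)) z.2 := fun hv =>
    ((θ.smoothFieldOn_hlift he' ho' hs' hv).contMDiffAt n2).mdifferentiableAt (by simp)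
  -- The field `V` on `P × P` is related through `q` to the field on the gauge groupoid, and through
  -- the two projections to the horizontal lifts on `P`.
  let V : (M → EM) → (M → EM) → P × P → EP × EP :=
    fun v v' y => (θ.hlift e v y.1, θ.hlift e' v' y.2)
  have dP : ∀ {v v' : M → EM}, SmoothFieldOn IM M v s → SmoothFieldOn IM M v' s' →
      MDifferentiableAt (IP.prod IP) (IP.prod IP).tangent
        (fun y => (⟨y, V v v' y⟩ : TangentBundle (IP.prod IP) (P × P))) z := by
    intro v v' hv hv'
    refine ((contMDiffOn_tangentBundle_prodMk
      ((θ.smoothFieldOn_hlift he ho hs hv).comp contMDiffOn_fst fun _ h => h.1)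
      ((θ.smoothFieldOn_hlift he' ho' hs' hv').comp contMDiffOn_snd
        fun _ h => h.2)).contMDiffAt n3).mdifferentiableAt (by simp)
  have rel : ∀ v v' : M → EM, ∀ᶠ y in 𝓝 z,
      mfderiv (IP.prod IP) (IM.prod (IG.prod IM)) B.arrow y (V v v' y) =
        K.compl (B.arrow y) (gaugeField he he' v v' (B.arrow y)) := by
    intro v v'
    filter_upwards [n3] with y hy
    exact (hK.compl_gaugeField he he' v v' ⟨hs hy.1, hs' hy.2⟩).symm
  have b0 := mfderiv_mlieBracket_of_related (B.contMDiff_arrow z) (V := V v v') (W := V w w')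
    (V' := fun c => K.compl c (gaugeField he he' v v' c))
    (W' := fun c => K.compl c (gaugeField he he' w w' c))
    (dP hv hv') (dP hw hw') (dG hv hv') (dG hw hw') (rel v v') (rel w w')
  have r1 : ∀ v v' : M → EM, ∀ᶠ y in 𝓝 z,
      mfderiv (IP.prod IP) IP Prod.fst y (V v v' y) = θ.hlift e v y.1 :=
    fun v v' => .of_forall fun y => modelDeriv_fst (I := IP) (I' := IP) y (V v v' y)
  have r2 : ∀ v v' : M → EM, ∀ᶠ y in 𝓝 z,
      mfderiv (IP.prod IP) IP Prod.snd y (V v v' y) = θ.hlift e' v' y.2 :=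
    fun v v' => .of_forall fun y => modelDeriv_snd (I := IP) (I' := IP) y (V v v' y)
  -- Naturality under the projections splits the bracket on `P × P` into the brackets of the two
  -- components.
  have b1 := mfderiv_mlieBracket_of_related
    (contMDiffAt_fst : ContMDiffAt (IP.prod IP) IP ∞ Prod.fst z)
    (dP hv hv') (dP hw hw') (d1 hv) (d1 hw) (r1 v v') (r1 w w')
  have b2 := mfderiv_mlieBracket_of_related
    (contMDiffAt_snd : ContMDiffAt (IP.prod IP) IP ∞ Prod.snd z)
    (dP hv hv') (dP hw hw') (d2 hv') (d2 hw') (r2 v v') (r2 w w')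
  set L : EP × EP := VectorField.mlieBracket (IP.prod IP) (V v v') (V w w') z
  replace b1 : L.1 = _ := (modelDeriv_fst (I := IP) (I' := IP) z L).symm.trans b1
  replace b2 : L.2 = _ := (modelDeriv_snd (I := IP) (I' := IP) z L).symm.trans b2
  refine (congrArg (K.endo (B.arrow z)) b0.symm).trans ?_
  refine (hK.endo_arrow z.1 z.2 L.1 L.2).trans ?_
  rw [b1, b2]

end PrincipalBundle
end Gauge

/-! ### The curvature of `K` comes from the curvature of the connection -/

section Gauge

variable {EM HM EG HG EP HP : Type*}
  [NormedAddCommGroup EM] [NormedSpace ℝ EM] [TopologicalSpace HM]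
  [NormedAddCommGroup EG] [NormedSpace ℝ EG] [TopologicalSpace HG]
  [NormedAddCommGroup EP] [NormedSpace ℝ EP] [TopologicalSpace HP]
  {IM : ModelWithCorners ℝ EM HM} {IG : ModelWithCorners ℝ EG HG} {IP : ModelWithCorners ℝ EP HP}
  {M G P : Type*}
  [TopologicalSpace M] [ChartedSpace HM M] [TopologicalSpace P] [ChartedSpace HP P]
  [TopologicalSpace G] [ChartedSpace HG G] [Group G] [MulAction Gᵐᵒᵖ P]

namespace PrincipalBundle

variable {B : PrincipalBundle IM IG IP M G P}

/-- A vector field on `M`, smooth near `x`, with the value `v` at `x`. -/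
def localField (IM : ModelWithCorners ℝ EM HM) [IsManifold IM ∞ M]
    (x : M) (v : EM) : M → EM :=
  have : IsManifold IM 1 M := IsManifold.of_le (n := ∞) (by simp)
  fun y => FiberBundle.extend (E := (TangentSpace IM : M → Type _)) (x := x) EM v y

variable [IsManifold IM ∞ M]

theorem localField_self (x : M) (v : EM) : localField IM x v x = v := by
  have : IsManifold IM 1 M := IsManifold.of_le (n := ∞) (by simp)
  exact FiberBundle.extend_apply_self (E := (TangentSpace IM : M → Type _)) (F := EM) (x := x) v

theorem exists_smoothFieldOn_localField (x : M) (v w : EM) {t : Set M} (ht : t ∈ 𝓝 x) :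
    ∃ s ⊆ t, IsOpen s ∧ x ∈ s ∧ SmoothFieldOn IM M (localField IM x v) s ∧
      SmoothFieldOn IM M (localField IM x w) s := by
  have : IsManifold IM 1 M := IsManifold.of_le (n := ∞) (by simp)
  have h (v : EM) : ∃ s ∈ 𝓝 x, SmoothFieldOn IM M (localField IM x v) s :=
    FiberBundle.exists_contMDiffOn_extend (k := ∞) (V := (TangentSpace IM : M → Type _)) (x₀ := x) IM
      EM v
  obtain ⟨s, hs, hv⟩ := h v
  obtain ⟨s', hs', hw⟩ := h w
  have hn : s ∩ s' ∩ t ∈ 𝓝 x := Filter.inter_mem (Filter.inter_mem hs hs') ht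
  have hi : interior (s ∩ s' ∩ t) ⊆ s ∩ s' ∩ t := interior_subset
  exact ⟨interior (s ∩ s' ∩ t), fun y hy => (hi hy).2, isOpen_interior,
    mem_interior_iff_mem_nhds.2 hn, hv.mono fun y hy => (hi hy).1.1,
    hw.mono fun y hy => (hi hy).1.2⟩

variable [LieGroup IG ∞ G] [IsManifold IP ∞ P]

/-- The curvature of the connection `θ`: the vertical part of the bracket of the horizontal lifts
of two vector fields on the base which extend the projections of `X` and `Y`. -/
def Connection.curv (θ : B.Connection) (p : P) (X Y : EP) : EP :=
  have e := (B.exists_trivialization (B.proj p)).choose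
  θ.vert p (VectorField.mlieBracket IP
    (θ.hlift e (localField IM (B.proj p) (modelDeriv IP IM B.proj p X)))
    (θ.hlift e (localField IM (B.proj p) (modelDeriv IP IM B.proj p Y))) p)

variable [IM.Boundaryless] [IG.Boundaryless] [IP.Boundaryless]
  [FiniteDimensional ℝ EM] [FiniteDimensional ℝ EG] [FiniteDimensional ℝ EP]

/-- The curvature of `K` is induced by the curvature of the connection. -/
theorem Connection.Induces.curvature_arrow {θ : B.Connection}
    {K : VectorForm (IM.prod (IG.prod IM)) B.GaugeSpace 1} (hK : θ.Induces K) (p q : P)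
    (X Y : Fin 2 → EP) :
    (VectorForm.curvature hK.endo_endo (B.arrow (p, q)) (fun i =>
        modelDeriv (IP.prod IP) (IM.prod (IG.prod IM)) B.arrow (p, q) (X i, Y i)) : EM × EG × EM) =
      modelDeriv (IP.prod IP) (IM.prod (IG.prod IM)) B.arrow (p, q)
        (θ.curv p (X 0) (X 1), θ.curv q (Y 0) (Y 1)) := by
  -- The trivializations, and the extensions `v` and `v'` below, are those built into `θ.curv`, so
  -- the final formula matches by unfolding.
  obtain ⟨he, hp⟩ := (B.exists_trivialization (B.proj p)).choose_spec.symm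
  obtain ⟨he', hq⟩ := (B.exists_trivialization (B.proj q)).choose_spec.symm
  set e := (B.exists_trivialization (B.proj p)).choose with e_def
  set e' := (B.exists_trivialization (B.proj q)).choose with e'_def
  let v : Fin 2 → M → EM := fun i => localField IM (B.proj p) (modelDeriv IP IM B.proj p (X i))
  let v' : Fin 2 → M → EM := fun i => localField IM (B.proj q) (modelDeriv IP IM B.proj q (Y i))
  obtain ⟨s, hs, ho, hps, h0, h1⟩ := exists_smoothFieldOn_localField (IM := IM) (B.proj p)
    (modelDeriv IP IM B.proj p (X 0)) (modelDeriv IP IM B.proj p (X 1))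
    (e.open_baseSet.mem_nhds hp)
  obtain ⟨s', hs', ho', hqs, h0', h1'⟩ := exists_smoothFieldOn_localField (IM := IM) (B.proj q)
    (modelDeriv IP IM B.proj q (Y 0)) (modelDeriv IP IM B.proj q (Y 1))
    (e'.open_baseSet.mem_nhds hq)
  -- At `[(p, q)]` the given vectors and the induced fields have the same image under `Id - K`: the
  -- horizontal part of a vector is determined by its projection, and the extensions were chosen
  -- with the right values. The curvature therefore takes the same value on both.
  have hc (i : Fin 2) : K.compl (B.arrow (p, q))
      (modelDeriv (IP.prod IP) (IM.prod (IG.prod IM)) B.arrow (p, q) (X i, Y i)) =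
      K.compl (B.arrow (p, q)) (gaugeField he he' (v i) (v' i) (B.arrow (p, q))) := by
    refine (hK.compl_arrow (p, q) (X i) (Y i)).trans
      (Eq.trans ?_ (hK.compl_gaugeField he he' (v i) (v' i) (z := (p, q)) ⟨hp, hq⟩).symm)
    rw [θ.sub_vert_eq_hlift he (e.mem_source.2 hp) (localField_self (IM := IM) _ _).symm,
      θ.sub_vert_eq_hlift he' (e'.mem_source.2 hq) (localField_self (IM := IM) _ _).symm]
  have n : B.gaugeTgt ⁻¹' s ∩ B.gaugeSrc ⁻¹' s' ∈ 𝓝 (B.arrow (p, q)) :=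
    Filter.inter_mem ((ho.preimage B.continuous_gaugeTgt).mem_nhds hps)
      ((ho'.preimage B.continuous_gaugeSrc).mem_nhds hqs)
  have d {w w' : M → EM} (hw : SmoothFieldOn IM M w s) (hw' : SmoothFieldOn IM M w' s') :
      MDifferentiableAt (IM.prod (IG.prod IM)) (IM.prod (IG.prod IM)).tangent
        (fun c => (⟨c, gaugeField he he' w w' c⟩ :
          TangentBundle (IM.prod (IG.prod IM)) B.GaugeSpace)) (B.arrow (p, q)) :=
    ((smoothFieldOn_gaugeField he he' hs hs' hw hw').contMDiffAt n).mdifferentiableAt (by simp)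
  refine (VectorForm.curvatureBilin_congr hK.endo_endo (hc 0) (hc 1)).trans ?_
  refine (VectorForm.curvatureBilin_apply hK.endo_endo (d h0 h0') (d h1 h1')).trans ?_
  exact hK.curvatureOp_gaugeField he he' hs hs' ho ho' h0 h1 h0' h1' (z := (p, q)) hps hqs

end PrincipalBundle
end Gauge
end

/-! ### Existence, uniqueness and multiplicativity of the curvature -/

theorem mainTheorem5
    {EM HM EG HG EP HP : Type*}
    [NormedAddCommGroup EM] [NormedSpace ℝ EM] [FiniteDimensional ℝ EM] [TopologicalSpace HM]
    [NormedAddCommGroup EG] [NormedSpace ℝ EG] [FiniteDimensional ℝ EG] [TopologicalSpace HG]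
    [NormedAddCommGroup EP] [NormedSpace ℝ EP] [FiniteDimensional ℝ EP] [TopologicalSpace HP]
    {IM : ModelWithCorners ℝ EM HM} [IM.Boundaryless]
    {IG : ModelWithCorners ℝ EG HG} [IG.Boundaryless]
    {IP : ModelWithCorners ℝ EP HP} [IP.Boundaryless]
    {M G P : Type*}
    [TopologicalSpace M] [ChartedSpace HM M] [IsManifold IM ∞ M] [T2Space M]
    [TopologicalSpace G] [ChartedSpace HG G] [Group G] [LieGroup IG ∞ G] [T2Space G]
    [TopologicalSpace P] [ChartedSpace HP P] [IsManifold IP ∞ P] [T2Space P]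
    [MulAction Gᵐᵒᵖ P]
    (B : PrincipalBundle IM IG IP M G P) (θ : B.Connection)
    (K : VectorForm (IM.prod (IG.prod IM)) B.GaugeSpace 1) (hK : θ.Induces K) :
    ∃ R : VectorForm (IM.prod (IG.prod IM)) B.GaugeSpace 2,
      IsCurvature K R ∧ (∀ R', IsCurvature K R' → R' = R) ∧ B.gaugeGroupoid.IsMultiplicative R := by

  refine ⟨VectorForm.curvature hK.endo_endo, VectorForm.isCurvature_curvature _,
    fun R' h => h.unique (VectorForm.isCurvature_curvature _),
    PrincipalBundle.isMultiplicative_of_factors _ θ.curv (fun p X Y => θ.proj_vert p _)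
      hK.curvature_arrow⟩
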